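/- Let $\Gamma$ be the chain of $g$ loops connected by bridges. It has vertices $w_0,\dots,w_g$ and $v_1,\dots,v_{g+1}$. For $0\le k\le g$ a bridge of length $n_k$ joins $w_k$ to $v_{k+1}$, and for $1\le k\le g$ a top edge of length $\ell_k$ and a bottom edge of length $m_k$ join $v_k$ to $w_k$. Fix $m\ge 0$ and suppose that the edge lengths are admissible: $4gm_k<\ell_k$ and $2m\ell_k<\min\{n_{k-1},n_k\}$ for all $k$, and there is no nontrivial relation $c_1m_1+\cdots+c_gm_g=0$ with integers $|c_k|\le g+1$. Let $D$ be a $w_0$-reduced divisor on $\Gamma$ of degree $d$ and (Baker--Norine) rank $r\ge 0$. Put $d_0=\deg_{w_0}(D)$. Let $x_k$ be the counterclockwise distance (along the bottom edge first) from $v_k$ to the chip of $D$ on the $k$th loop, and $x_k=0$ if there is no such chip. Let $p_0,\dots,p_g\in\mathbb Z^r$ (coordinates numbered from $0$ to $r-1$) be the associated lingering lattice path: $p_0=(d_0,d_0-1,\dots,d_0-r+1)$, and $p_k-p_{k-1}$ is $(-1,\dots,-1)$ if $x_k=0$; it is the basis vector $e_j$ if $x_k\ne 0$, $x_k\equiv(p_{k-1}(j)+1)m_k$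 mod $\ell_k+m_k$ and both $p_{k-1}$ and $p_{k-1}+e_j$ lie in $\{y\in\mathbb Z^r : y_0>\cdots>y_{r-1}>0\}$; and otherwise it is $0$, and the step is called lingering. Suppose that the class of $D$ is vertex avoiding, that is, there are exactly $\rho=g-(r+1)(g-d+r)$ lingering steps, and for all $k$ and $j$ neither $x_k\equiv m_k$ nor $x_k\equiv p_{k-1}(j)m_k$ mod $\ell_k+m_k$. For $0\le i\le r$ let $D_i$ be the divisor equivalent to $D$ such that $D_i-i\,w_0-(r-i)\,v_{g+1}$ is effective. For a multiset $I\subset\{0,\dots,r\}$ of size $m$ let $\psi_I$ be a continuous piecewise linear function with integer slopes on $\Gamma$ such that $mD+\operatorname{div}(\psi_I)=\sum_{i\in I}D_i$; here $\operatorname{div}(\psi)$ has as multiplicity at each point the sum of the incoming slopes of $\psi$. If $md<2g+4$, then $\{\psi_I : \#I=m\}$ is tropically independent: there are no real numbers $b_I$ such that at every point $v$ of $\Gamma$ the minimum $\min_I\{\psi_I(v)+b_I\}$ is attained by at least two multisets $I$. -/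

import Mathlib

open Filter Topology

/-- A finite metric graph with vertex set `V` and edge set `E`: every edge `e` is a closed
interval `[0, len e]`, glued to the vertex `src e` at `0` and to the vertex `tgt e` at `len e`. -/
structure MetricGraph (V E : Type) where
  src : E → V
  tgt : E → V
  len : E → ℝ
  len_pos : ∀ e, 0 < len e

namespace MetricGraph

variable {V E : Type}

/-- The points of (the geometric realization of) a metric graph: its vertices and the interior
points of its edges. -/
inductive Point (G : MetricGraph V E) : Type
  | vertex (v : V) : Point G
  | inner (e : E) (t : ℝ) (h0 : 0 < t) (h1 : t < G.len e) : Point G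

/-- The parametrization `[0, len e] → Γ` of the edge `e`. -/
noncomputable def pt (G : MetricGraph V E) (e : E) (t : ℝ) : G.Point :=
  if h0 : 0 < t then
    if h1 : t < G.len e then .inner e t h0 h1 else .vertex (G.tgt e)
  else .vertex (G.src e)

open Classical in
/-- Sum over all tangent directions at a point. The direction of increasing parameter along `e` at
parameter `t` contributes `fwd e t`, the one of decreasing parameter contributes `bwd e t`. A vertex
has one direction for each end of an edge that is attached to it; an interior point of an edge has
two directions. -/
noncomputable def sumDirections [Fintype E] (G : MetricGraph V E) (fwd bwd : E → ℝ → ℤ) :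
    G.Point → ℤ
  | .vertex v => ∑ e, ((if G.src e = v then fwd e 0 else 0) +
        (if G.tgt e = v then bwd e (G.len e) else 0))
  | .inner e t _ _ => fwd e t + bwd e t

/-- Near parameter `t` of `e`, in the direction of increasing parameter, `f` is affine with
outgoing slope `n`. -/
def HasFwdSlope (G : MetricGraph V E) (f : G.Point → ℝ) (e : E) (t : ℝ) (n : ℤ) : Prop :=
  ∀ᶠ s in 𝓝[>] t, f (G.pt e s) = f (G.pt e t) + n * (s - t)

/-- Near parameter `t` of `e`, in the direction of decreasing parameter, `f` is affine with
outgoing slope `n`. -/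
def HasBwdSlope (G : MetricGraph V E) (f : G.Point → ℝ) (e : E) (t : ℝ) (n : ℤ) : Prop :=
  ∀ᶠ s in 𝓝[<] t, f (G.pt e s) = f (G.pt e t) + n * (t - s)

/-- Continuous piecewise linear functions with integer slopes: at every point, `f` is affine with
integer slope near the point in every tangent direction. (By compactness of the edges this gives
finitely many pieces on each edge, and it includes continuity.) -/
def IsPL (G : MetricGraph V E) (f : G.Point → ℝ) : Prop :=
  ∀ e t, (0 ≤ t → t < G.len e → ∃ n : ℤ, G.HasFwdSlope f e t n) ∧
    (0 < t → t ≤ G.len e → ∃ n : ℤ, G.HasBwdSlope f e t n)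

open Classical in
/-- The outgoing slope of `f` in the direction of increasing parameter. -/
noncomputable def fwdSlope (G : MetricGraph V E) (f : G.Point → ℝ) (e : E) (t : ℝ) : ℤ :=
  if h : ∃ n : ℤ, G.HasFwdSlope f e t n then h.choose else 0

open Classical in
/-- The outgoing slope of `f` in the direction of decreasing parameter. -/
noncomputable def bwdSlope (G : MetricGraph V E) (f : G.Point → ℝ) (e : E) (t : ℝ) : ℤ :=
  if h : ∃ n : ℤ, G.HasBwdSlope f e t n then h.choose else 0

/-- The divisor of a piecewise linear function: its multiplicity at a point is the sum of the
incoming slopes, that is, minus the sum of the outgoing slopes. -/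
noncomputable def div [Fintype E] (G : MetricGraph V E) (f : G.Point → ℝ) (x : G.Point) : ℤ :=
  -G.sumDirections (G.fwdSlope f) (G.bwdSlope f) x

/-- Divisors on a metric graph: finite formal integer combinations of points. -/
abbrev Divisor (G : MetricGraph V E) : Type := G.Point →₀ ℤ

/-- The degree of a divisor. -/
def degree {G : MetricGraph V E} (D : G.Divisor) : ℤ := D.sum fun _ n => n

/-- Effective divisors. -/
def IsEffective {G : MetricGraph V E} (D : G.Divisor) : Prop := ∀ x, 0 ≤ D x

/-- Linear equivalence: `D' = D + div f` for a piecewise linear `f` with integer slopes. -/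
def LinEquiv [Fintype E] {G : MetricGraph V E} (D D' : G.Divisor) : Prop :=
  ∃ f : G.Point → ℝ, G.IsPL f ∧ ∀ x, D' x = D x + G.div f x

/-- `D` has (Baker-Norine) rank `r`: `r` is the largest natural number `k` such that `D - F` is
equivalent to an effective divisor for every effective divisor `F` of degree `k`. -/
def HasRank [Fintype E] {G : MetricGraph V E} (D : G.Divisor) (r : ℕ) : Prop :=
  IsGreatest {k : ℕ | ∀ F : G.Divisor, IsEffective F → degree F = k →
    ∃ D' : G.Divisor, IsEffective D' ∧ LinEquiv (D - F) D'} r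

/-- Closed subgraphs: closed subsets of the graph with finitely many components; the latter is
expressed locally, in every tangent direction at every point one is either in the set or
outside of it for a while. -/
def IsClosedSubgraph (G : MetricGraph V E) (A : Set G.Point) : Prop :=
  ∀ e, IsClosed {t : ℝ | 0 ≤ t ∧ t ≤ G.len e ∧ G.pt e t ∈ A} ∧
    ∀ t, (0 ≤ t → t < G.len e →
        (∀ᶠ s in 𝓝[>] t, G.pt e s ∈ A) ∨ (∀ᶠ s in 𝓝[>] t, G.pt e s ∉ A)) ∧
      (0 < t → t ≤ G.len e →
        (∀ᶠ s in 𝓝[<] t, G.pt e s ∈ A) ∨ (∀ᶠ s in 𝓝[<] t, G.pt e s ∉ A))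

open Classical in
/-- The outdegree of `A` at `x`: the number of tangent directions at `x` that leave `A`. -/
noncomputable def outdeg [Fintype E] (G : MetricGraph V E) (A : Set G.Point) (x : G.Point) : ℤ :=
  G.sumDirections (fun e t => if ∀ᶠ s in 𝓝[>] t, G.pt e s ∉ A then 1 else 0)
    (fun e t => if ∀ᶠ s in 𝓝[<] t, G.pt e s ∉ A then 1 else 0) x

/-- `D` is reduced with respect to the point `q`: it is effective away from `q`, and no nonempty
closed subgraph that avoids `q` can fire, that is, every such subgraph contains a point with fewer
chips than directions that leave the subgraph. -/
def IsReduced [Fintype E] {G : MetricGraph V E} (D : G.Divisor) (q : G.Point) : Prop :=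
  (∀ x, x ≠ q → 0 ≤ D x) ∧
    ∀ A : Set G.Point, G.IsClosedSubgraph A → A.Nonempty → q ∉ A →
      ∃ x ∈ A, D x < G.outdeg A x

end MetricGraph

/-- A family of real functions is tropically dependent if constants can be added to its members so
that the minimum is attained at least twice at every point. -/
def TropicallyDependent {X ι : Type*} (ψ : ι → X → ℝ) : Prop :=
  ∃ b : ι → ℝ, ∀ x, ∃ i j, i ≠ j ∧ ψ i x + b i = ψ j x + b j ∧
    ∀ k, ψ i x + b i ≤ ψ k x + b k

/-- Tropical independence. -/
def TropicallyIndependent {X ι : Type*} (ψ : ι → X → ℝ) : Prop := ¬ TropicallyDependent ψ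

/-- The edge lengths of a chain of `g` loops. The loops are numbered from `0` here, so that the
index `k : Fin g` stands for the loop number `k + 1`; `top k` and `bot k` are the lengths of its top
and bottom edge, and `bridge j` is the length of the bridge number `j`, for `0 ≤ j ≤ g`. -/
structure ChainOfLoops (g : ℕ) where
  top : Fin g → ℝ
  bot : Fin g → ℝ
  bridge : Fin (g + 1) → ℝ
  top_pos : ∀ k, 0 < top k
  bot_pos : ∀ k, 0 < bot k
  bridge_pos : ∀ j, 0 < bridge j

namespace ChainOfLoops

variable {g : ℕ}

/-- The `2g + 2` vertices: `w j` is the left end and `v j` is the right end of the bridge number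
`j`, so that `v j` is the vertex usually called `v_{j+1}`. -/
inductive Vertex (g : ℕ) : Type
  | w (j : Fin (g + 1)) : Vertex g
  | v (j : Fin (g + 1)) : Vertex g

/-- The `3g + 1` edges. -/
inductive Edge (g : ℕ) : Type
  | bridge (j : Fin (g + 1)) : Edge g
  | top (k : Fin g) : Edge g
  | bot (k : Fin g) : Edge g

/-- The edges as a disjoint union, which shows that there are finitely many. -/
def edgeEquiv (g : ℕ) : Fin (g + 1) ⊕ (Fin g ⊕ Fin g) ≃ Edge g where
  toFun
    | .inl j => .bridge j
    | .inr (.inl k) => .top k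
    | .inr (.inr k) => .bot k
  invFun
    | .bridge j => .inl j
    | .top k => .inr (.inl k)
    | .bot k => .inr (.inr k)
  left_inv := by rintro (_ | _ | _) <;> rfl
  right_inv := by rintro (_ | _ | _) <;> rfl

instance : Fintype (Edge g) := Fintype.ofEquiv _ (edgeEquiv g)

/-- The chain of loops as a metric graph. All edges are oriented from left to right; the bridge `j`
joins `w j` to `v j`, and the two edges of the loop with index `k` join the right end of
the bridge before it to the left end of the bridge after it. -/
def graph (Γ : ChainOfLoops g) : MetricGraph (Vertex g) (Edge g) where
  src
    | .bridge j => .w j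
    | .top k => .v k.castSucc
    | .bot k => .v k.castSucc
  tgt
    | .bridge j => .v j
    | .top k => .w k.succ
    | .bot k => .w k.succ
  len
    | .bridge j => Γ.bridge j
    | .top k => Γ.top k
    | .bot k => Γ.bot k
  len_pos
    | .bridge j => Γ.bridge_pos j
    | .top k => Γ.top_pos k
    | .bot k => Γ.bot_pos k

/-- The left end `w_0` of the chain. -/
def leftEnd (Γ : ChainOfLoops g) : Γ.graph.Point := .vertex (.w 0)

/-- The right end `v_{g+1}` of the chain. -/
def rightEnd (Γ : ChainOfLoops g) : Γ.graph.Point := .vertex (.v (Fin.last g))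

/-- Admissible edge lengths, for the study of multisets of size `m`. -/
structure Admissible (Γ : ChainOfLoops g) (m : ℕ) : Prop where
  bot_lt_top : ∀ k, 4 * g * Γ.bot k < Γ.top k
  top_lt_bridge : ∀ k, 2 * m * Γ.top k < min (Γ.bridge k.castSucc) (Γ.bridge k.succ)
  no_relation : ∀ c : Fin g → ℤ, (∀ k, |c k| ≤ g + 1) → ∑ k, c k * Γ.bot k = 0 → c = 0

/-- The circumference of the loop with index `k`. -/
def circ (Γ : ChainOfLoops g) (k : Fin g) : ℝ := Γ.top k + Γ.bot k

/-- The point of the loop with index `k` at counterclockwise distance `x` from its left vertex, for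
`0 ≤ x < circ k`: first along the bottom edge, then back along the top edge. -/
noncomputable def loopPoint (Γ : ChainOfLoops g) (k : Fin g) (x : ℝ) : Γ.graph.Point :=
  if x ≤ Γ.bot k then Γ.graph.pt (.bot k) x else Γ.graph.pt (.top k) (Γ.circ k - x)

open Classical in
/-- For a divisor `D` that is reduced with respect to the left end of the chain (so that it has at
most one chip on the loop, and none at the left vertex of the loop): the
counterclockwise distance from the left vertex of the loop to the chip on the loop,
or `0` if there is no chip. -/
noncomputable def chipPos (Γ : ChainOfLoops g) (D : Γ.graph.Divisor) (k : Fin g) : ℝ :=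
  if h : ∃ x, 0 < x ∧ x < Γ.circ k ∧ D (Γ.loopPoint k x) ≠ 0 then h.choose else 0

/-- The open Weyl chamber `y_0 > ⋯ > y_{r-1} > 0`. -/
def weylChamber (r : ℕ) : Set (Fin r → ℤ) := {y | StrictAnti y ∧ ∀ j, 0 < y j}

/-- The condition under which the lattice path goes from `p` in the coordinate direction `j` at the
loop with index `k`. -/
def IsStepDirection (Γ : ChainOfLoops g) (D : Γ.graph.Divisor) {r : ℕ} (k : Fin g)
    (p : Fin r → ℤ) (j : Fin r) : Prop :=
  (Γ.chipPos D k ≡ (p j + 1) * Γ.bot k [PMOD Γ.circ k]) ∧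
    p ∈ weylChamber r ∧ p + Pi.single j 1 ∈ weylChamber r

open Classical in
/-- One step of the lingering lattice path, from `p`, at the loop with index `k`. -/
noncomputable def step (Γ : ChainOfLoops g) (D : Γ.graph.Divisor) {r : ℕ} (k : Fin g)
    (p : Fin r → ℤ) : Fin r → ℤ :=
  if Γ.chipPos D k = 0 then p - 1
  else if h : ∃ j, Γ.IsStepDirection D k p j then p + Pi.single h.choose 1
  else p

/-- The lingering lattice path `p_0, …, p_g` in `ℤ ^ r` of the reduced divisor `D`. It
starts at `(d_0, d_0 - 1, …, d_0 - r + 1)`, where `d_0` is the number of chips of `D` at the left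
end; the loop with index `k` gives the step from `p_k` to `p_{k+1}`. -/
noncomputable def latticePath (Γ : ChainOfLoops g) (D : Γ.graph.Divisor) (r : ℕ) :
    Fin (g + 1) → Fin r → ℤ :=
  Fin.induction (motive := fun _ => Fin r → ℤ) (fun j => D Γ.leftEnd - (j : ℕ))
    (fun k p => Γ.step D k p)

/-- The step at the loop with index `k` is a lingering step: it is of neither of the two types
`(-1, …, -1)` and `e_j`. -/
def IsLingering (Γ : ChainOfLoops g) (D : Γ.graph.Divisor) (r : ℕ) (k : Fin g) : Prop :=
  Γ.chipPos D k ≠ 0 ∧ ¬ ∃ j, Γ.IsStepDirection D k (Γ.latticePath D r k.castSucc) j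

/-- The Brill-Noether number. -/
def brillNoetherNumber (g r d : ℕ) : ℤ := (g : ℤ) - (r + 1) * (g - d + r)

/-- The class of the divisor `D`, which is reduced with respect to the left end and has
degree `d` and rank `r`, is vertex avoiding. -/
structure IsVertexAvoiding (Γ : ChainOfLoops g) (D : Γ.graph.Divisor) (r d : ℕ) : Prop where
  lingering : (Set.ncard {k | Γ.IsLingering D r k} : ℤ) = brillNoetherNumber g r d
  ne_bot : ∀ k, ¬ (Γ.chipPos D k ≡ Γ.bot k [PMOD Γ.circ k])
  ne_path : ∀ k j,
    ¬ (Γ.chipPos D k ≡ Γ.latticePath D r k.castSucc j * Γ.bot k [PMOD Γ.circ k])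

end ChainOfLoops

/-! Suppose that `θ`, the minimum of the functions `ψ_I + b_I`, is attained twice everywhere.
Informally, `mD + div θ` is an effective divisor of degree `md`. The proof shows that it would have
at least two chips on each of the `g` loops and two more at each end of the chain, hence at least
`2g + 4` chips, against `md < 2g + 4`. The count is carried out with slopes on the bridges only.

Choose `φ i` with `D + div (φ i) = D_i`. Functions with divisor zero are constant
(`eq_of_div_eq_zero`), so `ψ_I` is, up to a constant, the sum of the `φ i` over `i ∈ I`.

Slopes of `φ i`. A reduced vertex avoiding divisor has its chips at `w_0` and at most one in the
interior of an edge of each loop. So `φ i` is concave on bridges. Across a loop its slope grows by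
at most the number of chips there, and equality fixes the position of the chip modulo the
circumference (`modEq_of_startSlope_succ_eq`). These facts form `SlopeBounds`. Induction from the
left bounds the slopes above by the lattice path (`path_bound`). The number of lingering steps
determines where the path ends (`last_eq`), and induction from the right bounds the slopes below
(`le_end`). Hence `φ i` is linear on every bridge with slope the `i`th coordinate of the path,
extended by a last coordinate zero.

Counting. Near the middle of a bridge two multisets with equal total slope attain the minimum
(`exists_isMinAt_pair`). On the first and last bridges the slopes are `r, …, 0`; as distinct
multisets of naturals with equal small sums do not exist (`Sym.map_sum_ge_two_of_ne`), the slope of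
the minimum is at most `mr - 2` at the start and at least `2` at the end. At a loop with `c` chips
of `D` it grows by at most `mc - 2` (`SlopeSystem.totalSlope_succ_le`): bridges are so long compared
with loops that a smaller drop leaves only two candidates `{j, …, j}` and `{i, j, …, j}` on the
whole loop, so that `φ j - φ i` would be constant there, which `not_diffConstOnLoop` excludes.
Summing over the loops gives `md ≥ 2g + 4`. -/

/-! ### Concavity on an interval. -/

/-- A function with integer one-sided slopes and nonpositive sums of outgoing slopes is concave:
its increments are bounded by the initial slope. -/
theorem sub_le_initial_slope_mul {F : ℝ → ℝ} {R L : ℝ → ℤ} {u v : ℝ}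
    (hR : ∀ t, u ≤ t → t < v → ∀ᶠ s in 𝓝[>] t, F s = F t + R t * (s - t))
    (hL : ∀ t, u < t → t ≤ v → ∀ᶠ s in 𝓝[<] t, F s = F t + L t * (t - s))
    (h : ∀ t, u < t → t < v → R t + L t ≤ 0) {s t : ℝ} (hus : u ≤ s) (hst : s ≤ t)
    (htv : t ≤ v) : F t - F s ≤ R u * (t - s) := by
  have cR : ∀ t, u ≤ t → t < v → ContinuousWithinAt F (Set.Ici t) t := by
    intro t h1 h2
    rw [← continuousWithinAt_Ioi_iff_Ici]
    have h3 : Tendsto (fun s => F t + R t * (s - t)) (𝓝[>] t) (𝓝 (F t + R t * (t - t))) :=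
      (Continuous.tendsto (by fun_prop) t).mono_left nhdsWithin_le_nhds
    rw [sub_self, mul_zero, add_zero] at h3
    exact h3.congr' ((hR t h1 h2).mono fun s hs => hs.symm)
  have cL : ∀ t, u < t → t ≤ v → ContinuousWithinAt F (Set.Iic t) t := by
    intro t h1 h2
    rw [← continuousWithinAt_Iio_iff_Iic]
    have h3 : Tendsto (fun s => F t + L t * (t - s)) (𝓝[<] t) (𝓝 (F t + L t * (t - t))) :=
      (Continuous.tendsto (by fun_prop) t).mono_left nhdsWithin_le_nhds
    rw [sub_self, mul_zero, add_zero] at h3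
    exact h3.congr' ((hL t h1 h2).mono fun s hs => hs.symm)
  have cF : ContinuousOn F (Set.Icc u v) := by
    rintro t ⟨h1, h2⟩
    rw [← Set.Icc_union_Icc_eq_Icc h1 h2]
    refine ContinuousWithinAt.union ?_ ?_
    · rcases h1.eq_or_lt with rfl | h1
      · simp
      · exact (cL t h1 h2).mono Set.Icc_subset_Iic_self
    · rcases h2.eq_or_lt with rfl | h2
      · simp
      · exact (cR t h1 h2).mono Set.Icc_subset_Ici_self
  set n : ℝ := (R u : ℝ) with hn
  set G : ℝ → ℝ := fun t => F t - n * t with hG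
  have cG : ContinuousOn G (Set.Icc u v) := cF.sub (by fun_prop)
  -- Continuous induction on `t` for the statement that `G t` is at most every earlier value of `G`.
  -- Writing `min s t` instead of assuming `s ≤ t` makes the condition visibly closed.
  set S : Set ℝ := {t | ∀ s ∈ Set.Icc u v, G t ≤ G (min s t)} with hS
  have hclosed : IsClosed (S ∩ Set.Icc u v) := by
    have : S ∩ Set.Icc u v = Set.Icc u v ∩ ⋂ s ∈ Set.Icc u v,
        {t ∈ Set.Icc u v | G t ≤ G (min s t)} := by
      ext t
      simp only [hS, Set.mem_inter_iff, Set.mem_ofPred_eq, Set.mem_iInter]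
      constructor
      · rintro ⟨h1, h2⟩
        exact ⟨h2, fun s hs => ⟨h2, h1 s hs⟩⟩
      · rintro ⟨h1, h2⟩
        exact ⟨fun s hs => (h2 s hs).2, h1⟩
    rw [this]
    refine isClosed_Icc.inter (isClosed_biInter fun s hs => ?_)
    refine isClosed_Icc.isClosed_le cG (cG.comp (by fun_prop) ?_)
    intro t ht
    exact ⟨le_min hs.1 ht.1, (min_le_right _ _).trans ht.2⟩
  have hsub : Set.Icc u v ⊆ S := by
    refine hclosed.Icc_subset_of_forall_exists_gt ?_ ?_
    · intro s hs
      rw [min_eq_right hs.1]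
    · rintro x ⟨hxS, hx1, hx2⟩ y hy
      -- `G` has not increased on the left of `x`, so the slope of `F` arriving at `x` is at most
      -- `n`; by `h` the slope can only drop at `x`.
      have hRx : (R x : ℝ) ≤ n := by
        rcases hx1.eq_or_lt with rfl | hx1
        · exact le_rfl
        · have h1 : (R x : ℝ) + L x ≤ 0 := by exact_mod_cast h x hx1 hx2
          have h2 : ∀ᶠ s in 𝓝[<] x, s ∈ Set.Ioo u x := Ioo_mem_nhdsLT hx1
          obtain ⟨s, hs1, hs2⟩ := ((hL x hx1 hx2.le).and h2).exists
          have h3 := hxS s ⟨hs2.1.le, hs2.2.le.trans hx2.le⟩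
          rw [min_eq_left hs2.2.le] at h3
          simp only [hG] at h3
          rw [hs1] at h3
          have h4 : 0 < x - s := sub_pos.2 hs2.2
          nlinarith
      obtain ⟨w, hw, hwF⟩ := (mem_nhdsGT_iff_exists_Ioo_subset' hx2).1 (hR x hx1 hx2)
      have hz : ∃ z, x < z ∧ z < w ∧ z ≤ y ∧ z < v := by
        obtain ⟨z, h1, h2⟩ := exists_between (lt_min (lt_min hw hy) hx2)
        simp only [lt_min_iff] at h2
        exact ⟨z, h1, h2.1.1, h2.1.2.le, h2.2⟩
      obtain ⟨z, h1, h2, h3, h4⟩ := hz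
      refine ⟨z, ?_, h1, h3⟩
      have hzF : ∀ s, x < s → s ≤ z → F s = F x + R x * (s - x) :=
        fun s hs1 hs2 => hwF ⟨hs1, hs2.trans_lt h2⟩
      have hzx : G z ≤ G x := by
        simp only [hG, hzF z h1 le_rfl]
        nlinarith
      intro s hs
      rcases le_total z s with h5 | h5
      · rw [min_eq_right h5]
      rw [min_eq_left h5]
      rcases le_or_gt s x with h6 | h6
      · have := hxS s hs
        rw [min_eq_left h6] at this
        exact hzx.trans this
      · simp only [hG, hzF z h1 le_rfl, hzF s h6 h5]
        nlinarith
  have := hsub ⟨hus.trans hst, htv⟩ s ⟨hus, hst.trans htv⟩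
  rw [min_eq_left hst] at this
  simp only [hG] at this
  linarith

/-- The mirror image of `sub_le_initial_slope_mul` under `t ↦ -t`, which exchanges `R` and `L`. -/
theorem final_slope_mul_le_sub {F : ℝ → ℝ} {R L : ℝ → ℤ} {u v : ℝ}
    (hR : ∀ t, u ≤ t → t < v → ∀ᶠ s in 𝓝[>] t, F s = F t + R t * (s - t))
    (hL : ∀ t, u < t → t ≤ v → ∀ᶠ s in 𝓝[<] t, F s = F t + L t * (t - s))
    (h : ∀ t, u < t → t < v → R t + L t ≤ 0) {s t : ℝ} (hus : u ≤ s) (hst : s ≤ t)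
    (htv : t ≤ v) : -L v * (t - s) ≤ F t - F s := by
  have := sub_le_initial_slope_mul (F := fun t => F (-t)) (R := fun t => L (-t))
    (L := fun t => R (-t)) (u := -v) (v := -u) ?_ ?_ ?_ (s := -t) (t := -s) (by linarith)
    (by linarith) (by linarith)
  · simp only [neg_neg] at this
    linarith
  · intro t h1 h2
    have h3 : Tendsto (fun s : ℝ => -s) (𝓝[>] t) (𝓝[<] (-t)) := tendsto_neg_nhdsGT
    refine (h3.eventually (hL (-t) (by linarith) (by linarith))).mono fun s hs => ?_
    rw [hs]; ring
  · intro t h1 h2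
    have h3 : Tendsto (fun s : ℝ => -s) (𝓝[<] t) (𝓝[>] (-t)) := tendsto_neg_nhdsLT
    refine (h3.eventually (hR (-t) (by linarith) (by linarith))).mono fun s hs => ?_
    rw [hs]; ring
  · intro t h1 h2
    have := h (-t) (by linarith) (by linarith)
    linarith

/-! ### Slopes and divisors of piecewise linear functions. -/

namespace MetricGraph

variable {V E : Type} {G : MetricGraph V E} {f f' : G.Point → ℝ} {e : E} {t : ℝ}

theorem pt_zero (G : MetricGraph V E) (e : E) : G.pt e 0 = .vertex (G.src e) := by
  simp [pt]

theorem pt_len (G : MetricGraph V E) (e : E) : G.pt e (G.len e) = .vertex (G.tgt e) := by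
  simp [pt, G.len_pos]

theorem pt_inner (h0 : 0 < t) (h1 : t < G.len e) : G.pt e t = .inner e t h0 h1 := by
  simp [pt, h0, h1]

theorem HasFwdSlope.unique {a b : ℤ} (ha : G.HasFwdSlope f e t a) (hb : G.HasFwdSlope f e t b) :
    a = b := by
  obtain ⟨s, ⟨h1, h2⟩, h3⟩ := ((Eventually.and ha hb).and
    (self_mem_nhdsWithin : ∀ᶠ s in 𝓝[>] t, s ∈ Set.Ioi t)).exists
  have h4 : (0 : ℝ) < s - t := sub_pos.2 h3
  have h5 : (a : ℝ) * (s - t) = b * (s - t) := by linarith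
  exact_mod_cast mul_right_cancel₀ h4.ne' h5

theorem HasBwdSlope.unique {a b : ℤ} (ha : G.HasBwdSlope f e t a) (hb : G.HasBwdSlope f e t b) :
    a = b := by
  obtain ⟨s, ⟨h1, h2⟩, h3⟩ := ((Eventually.and ha hb).and
    (self_mem_nhdsWithin : ∀ᶠ s in 𝓝[<] t, s ∈ Set.Iio t)).exists
  have h4 : (0 : ℝ) < t - s := sub_pos.2 h3
  have h5 : (a : ℝ) * (t - s) = b * (t - s) := by linarith
  exact_mod_cast mul_right_cancel₀ h4.ne' h5

theorem HasFwdSlope.fwdSlope_eq {n : ℤ} (h : G.HasFwdSlope f e t n) : G.fwdSlope f e t = n := by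
  have h' : ∃ n, G.HasFwdSlope f e t n := ⟨n, h⟩
  rw [fwdSlope, dif_pos h']
  exact h'.choose_spec.unique h

theorem HasBwdSlope.bwdSlope_eq {n : ℤ} (h : G.HasBwdSlope f e t n) : G.bwdSlope f e t = n := by
  have h' : ∃ n, G.HasBwdSlope f e t n := ⟨n, h⟩
  rw [bwdSlope, dif_pos h']
  exact h'.choose_spec.unique h

theorem IsPL.hasFwdSlope (hf : G.IsPL f) (h0 : 0 ≤ t) (h1 : t < G.len e) :
    G.HasFwdSlope f e t (G.fwdSlope f e t) := by
  obtain ⟨n, hn⟩ := (hf e t).1 h0 h1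
  rwa [hn.fwdSlope_eq]

theorem IsPL.hasBwdSlope (hf : G.IsPL f) (h0 : 0 < t) (h1 : t ≤ G.len e) :
    G.HasBwdSlope f e t (G.bwdSlope f e t) := by
  obtain ⟨n, hn⟩ := (hf e t).2 h0 h1
  rwa [hn.bwdSlope_eq]

theorem HasFwdSlope.add {a b : ℤ} (ha : G.HasFwdSlope f e t a) (hb : G.HasFwdSlope f' e t b) :
    G.HasFwdSlope (f + f') e t (a + b) := by
  filter_upwards [ha, hb] with s h1 h2
  simp only [Pi.add_apply, h1, h2]
  push_cast
  ring

theorem HasBwdSlope.add {a b : ℤ} (ha : G.HasBwdSlope f e t a) (hb : G.HasBwdSlope f' e t b) :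
    G.HasBwdSlope (f + f') e t (a + b) := by
  filter_upwards [ha, hb] with s h1 h2
  simp only [Pi.add_apply, h1, h2]
  push_cast
  ring

theorem HasFwdSlope.neg {a : ℤ} (ha : G.HasFwdSlope f e t a) : G.HasFwdSlope (-f) e t (-a) := by
  filter_upwards [ha] with s h1
  simp only [Pi.neg_apply, h1]
  push_cast
  ring

theorem HasBwdSlope.neg {a : ℤ} (ha : G.HasBwdSlope f e t a) : G.HasBwdSlope (-f) e t (-a) := by
  filter_upwards [ha] with s h1
  simp only [Pi.neg_apply, h1]
  push_cast
  ring

theorem hasFwdSlope_zero : G.HasFwdSlope 0 e t 0 := by simp [HasFwdSlope]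

theorem hasBwdSlope_zero : G.HasBwdSlope 0 e t 0 := by simp [HasBwdSlope]

theorem isPL_zero : G.IsPL 0 :=
  fun _ _ => ⟨fun _ _ => ⟨0, hasFwdSlope_zero⟩, fun _ _ => ⟨0, hasBwdSlope_zero⟩⟩

theorem IsPL.add (hf : G.IsPL f) (hf' : G.IsPL f') : G.IsPL (f + f') := fun _ _ =>
  ⟨fun h0 h1 => ⟨_, (hf.hasFwdSlope h0 h1).add (hf'.hasFwdSlope h0 h1)⟩,
    fun h0 h1 => ⟨_, (hf.hasBwdSlope h0 h1).add (hf'.hasBwdSlope h0 h1)⟩⟩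

theorem IsPL.neg (hf : G.IsPL f) : G.IsPL (-f) := fun _ _ =>
  ⟨fun h0 h1 => ⟨_, (hf.hasFwdSlope h0 h1).neg⟩, fun h0 h1 => ⟨_, (hf.hasBwdSlope h0 h1).neg⟩⟩

theorem isPL_multiset_sum {ι : Type*} {φ : ι → G.Point → ℝ} (hφ : ∀ i, G.IsPL (φ i))
    (s : Multiset ι) : G.IsPL (s.map φ).sum := by
  induction s using Multiset.induction with
  | empty => simpa using isPL_zero
  | cons i s ih => simpa using (hφ i).add ih

section Div

variable [Fintype E]

theorem div_inner (h0 : 0 < t) (h1 : t < G.len e) :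
    G.div f (G.pt e t) = -(G.fwdSlope f e t + G.bwdSlope f e t) := by
  rw [pt_inner h0 h1]; rfl

theorem div_zero (x : G.Point) : G.div 0 x = 0 := by
  have h1 : ∀ e t, G.fwdSlope 0 e t = 0 := fun e t => hasFwdSlope_zero.fwdSlope_eq
  have h2 : ∀ e t, G.bwdSlope 0 e t = 0 := fun e t => hasBwdSlope_zero.bwdSlope_eq
  cases x <;> simp [div, sumDirections, h1, h2]

theorem div_add (hf : G.IsPL f) (hf' : G.IsPL f') (x : G.Point) :
    G.div (f + f') x = G.div f x + G.div f' x := by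
  have h1 : ∀ e t, 0 ≤ t → t < G.len e →
      G.fwdSlope (f + f') e t = G.fwdSlope f e t + G.fwdSlope f' e t :=
    fun e t h0 h1 => ((hf.hasFwdSlope h0 h1).add (hf'.hasFwdSlope h0 h1)).fwdSlope_eq
  have h2 : ∀ e t, 0 < t → t ≤ G.len e →
      G.bwdSlope (f + f') e t = G.bwdSlope f e t + G.bwdSlope f' e t :=
    fun e t h0 h1 => ((hf.hasBwdSlope h0 h1).add (hf'.hasBwdSlope h0 h1)).bwdSlope_eq
  cases x with
  | vertex v =>
    simp only [div, sumDirections]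
    rw [← neg_add, ← Finset.sum_add_distrib]
    congr 1
    refine Finset.sum_congr rfl fun e _ => ?_
    rw [h1 e 0 le_rfl (G.len_pos e), h2 e _ (G.len_pos e) le_rfl]
    split_ifs <;> ring
  | inner e t h0 h3 =>
    simp only [div, sumDirections]
    rw [h1 e t h0.le h3, h2 e t h0 h3.le]
    ring

theorem div_neg (hf : G.IsPL f) (x : G.Point) : G.div (-f) x = -G.div f x := by
  have := div_add hf hf.neg x
  rw [add_neg_cancel, div_zero] at this
  linarith

theorem div_multiset_sum {ι : Type*} {φ : ι → G.Point → ℝ} (hφ : ∀ i, G.IsPL (φ i))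
    (s : Multiset ι) (x : G.Point) :
    G.div (s.map φ).sum x = (s.map fun i => G.div (φ i) x).sum := by
  induction s using Multiset.induction with
  | empty => simpa using div_zero x
  | cons i s ih => simpa [ih] using div_add (hφ i) (isPL_multiset_sum hφ s) x

end Div

/-! ### Moving chips along a single edge. -/

section Interval

variable {u v a b : ℝ}

theorem IsPL.sub_le (hf : G.IsPL f) (hu : 0 ≤ u) (hv : v ≤ G.len e)
    (h : ∀ t, u < t → t < v → G.fwdSlope f e t + G.bwdSlope f e t ≤ 0)
    (hua : u ≤ a) (hab : a ≤ b) (hbv : b ≤ v) :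
    f (G.pt e b) - f (G.pt e a) ≤ G.fwdSlope f e u * (b - a) :=
  sub_le_initial_slope_mul (F := fun t => f (G.pt e t))
    (fun _ h0 h1 => hf.hasFwdSlope (hu.trans h0) (h1.trans_le hv))
    (fun _ h0 h1 => hf.hasBwdSlope (hu.trans_lt h0) (h1.trans hv)) h hua hab hbv

theorem IsPL.le_sub (hf : G.IsPL f) (hu : 0 ≤ u) (hv : v ≤ G.len e)
    (h : ∀ t, u < t → t < v → G.fwdSlope f e t + G.bwdSlope f e t ≤ 0)
    (hua : u ≤ a) (hab : a ≤ b) (hbv : b ≤ v) :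
    -G.bwdSlope f e v * (b - a) ≤ f (G.pt e b) - f (G.pt e a) :=
  final_slope_mul_le_sub (F := fun t => f (G.pt e t))
    (fun _ h0 h1 => hf.hasFwdSlope (hu.trans h0) (h1.trans_le hv))
    (fun _ h0 h1 => hf.hasBwdSlope (hu.trans_lt h0) (h1.trans hv)) h hua hab hbv

theorem IsPL.neg_bwdSlope_le_fwdSlope (hf : G.IsPL f) (hu : 0 ≤ u) (huv : u < v)
    (hv : v ≤ G.len e)
    (h : ∀ t, u < t → t < v → G.fwdSlope f e t + G.bwdSlope f e t ≤ 0) :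
    -G.bwdSlope f e v ≤ G.fwdSlope f e u := by
  have h1 := (hf.le_sub hu hv h le_rfl huv.le le_rfl).trans
    (hf.sub_le hu hv h le_rfl huv.le le_rfl)
  exact_mod_cast le_of_mul_le_mul_right h1 (sub_pos.2 huv)

/-- An edge whose interior carries at most the chip at the parameter `y`, and from which `f` takes
no further chips. -/
structure IsEdgeMove [Fintype E] (G : MetricGraph V E) (f : G.Point → ℝ) (e : E) (y : ℝ) :
    Prop where
  isPL : G.IsPL f
  le_div : ∀ t, 0 < t → t < G.len e → -(if t = y then 1 else 0) ≤ G.div f (G.pt e t)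

/-- The number of chips that the edge carries before the move. -/
noncomputable def chipCount (G : MetricGraph V E) (e : E) (y : ℝ) : ℤ :=
  open Classical in if 0 < y ∧ y < G.len e then 1 else 0

/-- The number of chips in the interior of the edge `e` after moving chips along `f`, if a chip was
at the parameter `y` before. -/
noncomputable def chipsAfter (G : MetricGraph V E) (f : G.Point → ℝ) (e : E) (y : ℝ) : ℤ :=
  G.fwdSlope f e 0 + G.bwdSlope f e (G.len e) + G.chipCount e y

section EdgeMove

variable [Fintype E] {y : ℝ}

theorem IsEdgeMove.slopes_le (h : G.IsEdgeMove f e y) (h0 : 0 < t) (h1 : t < G.len e) :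
    G.fwdSlope f e t + G.bwdSlope f e t ≤ if t = y then 1 else 0 := by
  have := h.le_div t h0 h1
  rw [div_inner h0 h1] at this
  linarith

theorem IsEdgeMove.slopes_nonpos (h : G.IsEdgeMove f e y) (h0 : 0 < t) (h1 : t < G.len e)
    (hy : t ≠ y) : G.fwdSlope f e t + G.bwdSlope f e t ≤ 0 := by
  simpa [hy] using h.slopes_le h0 h1

/-- From left to right the slope of `f` never rises, except by at most one at the chip `y`. -/
theorem IsEdgeMove.chipsAfter_nonneg (h : G.IsEdgeMove f e y) : 0 ≤ G.chipsAfter f e y := by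
  unfold chipsAfter chipCount
  split_ifs with hy
  · have h1 := h.isPL.neg_bwdSlope_le_fwdSlope le_rfl hy.1 hy.2.le
      fun t h0 h1 => h.slopes_nonpos h0 (h1.trans hy.2) h1.ne
    have h2 := h.isPL.neg_bwdSlope_le_fwdSlope hy.1.le hy.2 le_rfl
      fun t h0 h1 => h.slopes_nonpos (hy.1.trans h0) h1 h0.ne'
    have h3 := h.slopes_le hy.1 hy.2
    rw [if_pos rfl] at h3
    linarith
  · have h1 := h.isPL.neg_bwdSlope_le_fwdSlope le_rfl (G.len_pos e) le_rfl
      fun t h0 h1 => h.slopes_nonpos h0 h1 (by rintro rfl; exact hy ⟨h0, h1⟩)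
    linarith

/-- If no chip remains, all slope inequalities are equalities: the slope is constant up to the chip,
and larger by one after it. -/
theorem IsEdgeMove.sub_eq (h : G.IsEdgeMove f e y) (h0 : G.chipsAfter f e y = 0) :
    f (G.pt e (G.len e)) - f (G.pt e 0) =
      G.fwdSlope f e 0 * G.len e + G.chipCount e y * (G.len e - y) := by
  unfold chipsAfter chipCount at *
  split_ifs at h0 ⊢ with hy
  · have n1 : ∀ t, 0 < t → t < y → G.fwdSlope f e t + G.bwdSlope f e t ≤ 0 :=
      fun t h0 h1 => h.slopes_nonpos h0 (h1.trans hy.2) h1.ne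
    have n2 : ∀ t, y < t → t < G.len e → G.fwdSlope f e t + G.bwdSlope f e t ≤ 0 :=
      fun t h0 h1 => h.slopes_nonpos (hy.1.trans h0) h1 h0.ne'
    have h1 := h.isPL.neg_bwdSlope_le_fwdSlope le_rfl hy.1 hy.2.le n1
    have h2 := h.isPL.neg_bwdSlope_le_fwdSlope hy.1.le hy.2 le_rfl n2
    have h3 := h.slopes_le hy.1 hy.2
    rw [if_pos rfl] at h3
    have a1 := h.isPL.sub_le le_rfl hy.2.le n1 le_rfl hy.1.le le_rfl
    have a2 := h.isPL.le_sub le_rfl hy.2.le n1 le_rfl hy.1.le le_rfl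
    have a3 := h.isPL.sub_le hy.1.le le_rfl n2 le_rfl hy.2.le le_rfl
    have a4 := h.isPL.le_sub hy.1.le le_rfl n2 le_rfl hy.2.le le_rfl
    have e1 : G.bwdSlope f e y = -G.fwdSlope f e 0 := by linarith
    have e2 : G.fwdSlope f e y = G.fwdSlope f e 0 + 1 := by linarith
    have e3 : G.bwdSlope f e (G.len e) = -(G.fwdSlope f e 0 + 1) := by linarith
    rw [e1] at a2
    rw [e2] at a3
    rw [e3] at a4
    push_cast at *
    linarith
  · have n : ∀ t, 0 < t → t < G.len e → G.fwdSlope f e t + G.bwdSlope f e t ≤ 0 :=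
      fun t h0 h1 => h.slopes_nonpos h0 h1 (by rintro rfl; exact hy ⟨h0, h1⟩)
    have a1 := h.isPL.sub_le le_rfl le_rfl n le_rfl (G.len_pos e).le le_rfl
    have a2 := h.isPL.le_sub le_rfl le_rfl n le_rfl (G.len_pos e).le le_rfl
    have e1 : G.bwdSlope f e (G.len e) = -G.fwdSlope f e 0 := by linarith
    rw [e1] at a2
    push_cast at *
    linarith

/-- The slope rises by at most one, at the chip `y`, and chips left behind account for every drop;
with at most one of each, all slopes on the edge lie among two consecutive integers. -/
theorem IsEdgeMove.exists_slope_bounds (h : G.IsEdgeMove f e y) (h1 : G.chipsAfter f e y ≤ 1) :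
    ∃ lo hi : ℤ, G.fwdSlope f e 0 - G.chipsAfter f e y ≤ lo ∧
      hi ≤ G.fwdSlope f e 0 + G.chipCount e y ∧ hi ≤ lo + 1 ∧
      ∀ s t, 0 ≤ s → s ≤ t → t ≤ G.len e →
        lo * (t - s) ≤ f (G.pt e t) - f (G.pt e s) ∧
        f (G.pt e t) - f (G.pt e s) ≤ hi * (t - s) := by
  unfold chipsAfter chipCount at *
  split_ifs at h1 ⊢ with hy
  · have n1 : ∀ t, 0 < t → t < y → G.fwdSlope f e t + G.bwdSlope f e t ≤ 0 :=
      fun t h0 h1 => h.slopes_nonpos h0 (h1.trans hy.2) h1.ne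
    have n2 : ∀ t, y < t → t < G.len e → G.fwdSlope f e t + G.bwdSlope f e t ≤ 0 :=
      fun t h0 h1 => h.slopes_nonpos (hy.1.trans h0) h1 h0.ne'
    have i1 := h.isPL.neg_bwdSlope_le_fwdSlope le_rfl hy.1 hy.2.le n1
    have i2 := h.isPL.neg_bwdSlope_le_fwdSlope hy.1.le hy.2 le_rfl n2
    have i3 := h.slopes_le hy.1 hy.2
    rw [if_pos rfl] at i3
    set lo := min (-G.bwdSlope f e y) (-G.bwdSlope f e (G.len e)) with hlo
    set hi := max (G.fwdSlope f e 0) (G.fwdSlope f e y) with hhi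
    have b1 : ∀ s t, 0 ≤ s → s ≤ t → t ≤ y → lo * (t - s) ≤ f (G.pt e t) - f (G.pt e s) ∧
        f (G.pt e t) - f (G.pt e s) ≤ hi * (t - s) := by
      intro s t hs hst ht
      have c1 : (lo : ℝ) ≤ -G.bwdSlope f e y := by exact_mod_cast min_le_left _ _
      have c2 : (G.fwdSlope f e 0 : ℝ) ≤ hi := by exact_mod_cast le_max_left _ _
      exact ⟨(mul_le_mul_of_nonneg_right c1 (sub_nonneg.2 hst)).trans
          (h.isPL.le_sub le_rfl hy.2.le n1 hs hst ht),
        (h.isPL.sub_le le_rfl hy.2.le n1 hs hst ht).trans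
          (mul_le_mul_of_nonneg_right c2 (sub_nonneg.2 hst))⟩
    have b2 : ∀ s t, y ≤ s → s ≤ t → t ≤ G.len e →
        lo * (t - s) ≤ f (G.pt e t) - f (G.pt e s) ∧
        f (G.pt e t) - f (G.pt e s) ≤ hi * (t - s) := by
      intro s t hs hst ht
      have c1 : (lo : ℝ) ≤ -G.bwdSlope f e (G.len e) := by exact_mod_cast min_le_right _ _
      have c2 : (G.fwdSlope f e y : ℝ) ≤ hi := by exact_mod_cast le_max_right _ _
      exact ⟨(mul_le_mul_of_nonneg_right c1 (sub_nonneg.2 hst)).trans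
          (h.isPL.le_sub hy.1.le le_rfl n2 hs hst ht),
        (h.isPL.sub_le hy.1.le le_rfl n2 hs hst ht).trans
          (mul_le_mul_of_nonneg_right c2 (sub_nonneg.2 hst))⟩
    refine ⟨lo, hi, le_min (by linarith) (by linarith), max_le (by linarith) (by linarith),
      max_le ?_ ?_, fun s t hs hst ht => ?_⟩
    · rw [hlo, ← min_add_add_right]
      exact le_min (by linarith) (by linarith)
    · rw [hlo, ← min_add_add_right]
      exact le_min (by linarith) (by linarith)
    · rcases le_total t y with h3 | h3
      · exact b1 s t hs hst h3
      rcases le_total y s with h4 | h4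
      · exact b2 s t h4 hst ht
      have c1 := b1 s y hs h4 le_rfl
      have c2 := b2 y t le_rfl h3 ht
      constructor <;> nlinarith [c1.1, c1.2, c2.1, c2.2]
  · have n : ∀ t, 0 < t → t < G.len e → G.fwdSlope f e t + G.bwdSlope f e t ≤ 0 :=
      fun t h0 h1 => h.slopes_nonpos h0 h1 (by rintro rfl; exact hy ⟨h0, h1⟩)
    refine ⟨-G.bwdSlope f e (G.len e), G.fwdSlope f e 0, by linarith, by linarith, by linarith,
      fun s t hs hst ht => ⟨?_, h.isPL.sub_le le_rfl le_rfl n hs hst ht⟩⟩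
    have := h.isPL.le_sub le_rfl le_rfl n hs hst ht
    push_cast
    linarith

end EdgeMove

end Interval

end MetricGraph

/-! ### Boxes as test sets for reduced divisors. -/

namespace MetricGraph

variable {V E : Type} {G : MetricGraph V E}

/-- The set of points of a metric graph that meets every edge in an interval. -/
def box (G : MetricGraph V E) (S : Set V) (lo hi : E → ℝ) : Set G.Point :=
  {x | match x with
    | .vertex v => v ∈ S
    | .inner e t _ _ => lo e ≤ t ∧ t ≤ hi e}

/-- The vertices of the box are those whose edges meet it there. -/
structure IsBox (G : MetricGraph V E) (S : Set V) (lo hi : E → ℝ) : Prop where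
  src_mem : ∀ e, G.src e ∈ S ↔ lo e ≤ 0 ∧ 0 ≤ hi e
  tgt_mem : ∀ e, G.tgt e ∈ S ↔ lo e ≤ G.len e ∧ G.len e ≤ hi e

section Box

variable {S : Set V} {lo hi : E → ℝ} {e : E} {t : ℝ}

theorem IsBox.pt_mem (h : G.IsBox S lo hi) (h0 : 0 ≤ t) (h1 : t ≤ G.len e) :
    G.pt e t ∈ G.box S lo hi ↔ lo e ≤ t ∧ t ≤ hi e := by
  rcases h0.eq_or_lt with rfl | h0
  · rw [pt_zero]; exact h.src_mem e
  rcases h1.eq_or_lt with rfl | h1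
  · rw [pt_len]; exact h.tgt_mem e
  rw [pt_inner h0 h1]; rfl

theorem IsBox.eventually_fwd_mem (h : G.IsBox S lo hi) (h0 : 0 ≤ t) (h1 : t < G.len e)
    (hlo : lo e ≤ t) (hhi : t < hi e) : ∀ᶠ s in 𝓝[>] t, G.pt e s ∈ G.box S lo hi := by
  filter_upwards [Ioo_mem_nhdsGT h1, Ioo_mem_nhdsGT hhi] with s h2 h3
  exact (h.pt_mem (h0.trans h2.1.le) h2.2.le).2 ⟨hlo.trans h2.1.le, h3.2.le⟩

theorem IsBox.eventually_bwd_mem (h : G.IsBox S lo hi) (h0 : 0 < t) (h1 : t ≤ G.len e)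
    (hlo : lo e < t) (hhi : t ≤ hi e) : ∀ᶠ s in 𝓝[<] t, G.pt e s ∈ G.box S lo hi := by
  filter_upwards [Ioo_mem_nhdsLT h0, Ioo_mem_nhdsLT hlo] with s h2 h3
  exact (h.pt_mem h2.1.le (h2.2.le.trans h1)).2 ⟨h3.1.le, h2.2.le.trans hhi⟩

theorem IsBox.isClosedSubgraph (h : G.IsBox S lo hi) : G.IsClosedSubgraph (G.box S lo hi) := by
  intro e
  refine ⟨?_, fun t => ⟨fun h0 h1 => ?_, fun h0 h1 => ?_⟩⟩
  · have : {t : ℝ | 0 ≤ t ∧ t ≤ G.len e ∧ G.pt e t ∈ G.box S lo hi} =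
        Set.Icc 0 (G.len e) ∩ Set.Icc (lo e) (hi e) := by
      ext t
      constructor
      · rintro ⟨h0, h1, h2⟩
        exact ⟨⟨h0, h1⟩, (h.pt_mem h0 h1).1 h2⟩
      · rintro ⟨⟨h0, h1⟩, h2⟩
        exact ⟨h0, h1, (h.pt_mem h0 h1).2 h2⟩
    rw [this]
    exact isClosed_Icc.inter isClosed_Icc
  · rcases lt_or_ge t (lo e) with h2 | h2
    · right
      filter_upwards [Ioo_mem_nhdsGT h1, Ioo_mem_nhdsGT h2] with s h3 h4
      rw [h.pt_mem (h0.trans h3.1.le) h3.2.le]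
      exact fun h5 => absurd h5.1 (not_le.2 h4.2)
    rcases lt_or_ge t (hi e) with h3 | h3
    · exact .inl (h.eventually_fwd_mem h0 h1 h2 h3)
    · right
      filter_upwards [Ioo_mem_nhdsGT h1] with s h4
      rw [h.pt_mem (h0.trans h4.1.le) h4.2.le]
      exact fun h5 => absurd h5.2 (not_le.2 (h3.trans_lt h4.1))
  · rcases lt_or_ge (hi e) t with h2 | h2
    · right
      filter_upwards [Ioo_mem_nhdsLT h0, Ioo_mem_nhdsLT h2] with s h3 h4
      rw [h.pt_mem h3.1.le (h3.2.le.trans h1)]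
      exact fun h5 => absurd h5.2 (not_le.2 h4.1)
    rcases lt_or_ge (lo e) t with h3 | h3
    · exact .inl (h.eventually_bwd_mem h0 h1 h3 h2)
    · right
      filter_upwards [Ioo_mem_nhdsLT h0] with s h4
      rw [h.pt_mem h4.1.le (h4.2.le.trans h1)]
      exact fun h5 => absurd h5.1 (not_le.2 (h4.2.trans_le h3))

open Classical in
/-- Whether the direction of increasing parameter leaves `A`. -/
noncomputable def fwdOut (G : MetricGraph V E) (A : Set G.Point) (e : E) (t : ℝ) : ℤ :=
  if ∀ᶠ s in 𝓝[>] t, G.pt e s ∉ A then 1 else 0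

open Classical in
/-- Whether the direction of decreasing parameter leaves `A`. -/
noncomputable def bwdOut (G : MetricGraph V E) (A : Set G.Point) (e : E) (t : ℝ) : ℤ :=
  if ∀ᶠ s in 𝓝[<] t, G.pt e s ∉ A then 1 else 0

theorem outdeg_eq [Fintype E] (A : Set G.Point) (x : G.Point) :
    G.outdeg A x = G.sumDirections (G.fwdOut A) (G.bwdOut A) x := rfl

theorem outdeg_inner [Fintype E] (A : Set G.Point) (h0 : 0 < t) (h1 : t < G.len e) :
    G.outdeg A (.inner e t h0 h1) = G.fwdOut A e t + G.bwdOut A e t := rfl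

theorem fwdOut_le_one (A : Set G.Point) (e : E) (t : ℝ) : G.fwdOut A e t ≤ 1 := by
  unfold fwdOut; split_ifs <;> norm_num

theorem bwdOut_le_one (A : Set G.Point) (e : E) (t : ℝ) : G.bwdOut A e t ≤ 1 := by
  unfold bwdOut; split_ifs <;> norm_num

theorem IsBox.fwdOut_eq_zero (h : G.IsBox S lo hi) (h0 : 0 ≤ t) (h1 : t < G.len e)
    (hlo : lo e ≤ t) (hhi : t < hi e) : G.fwdOut (G.box S lo hi) e t = 0 := by
  refine if_neg fun h2 => ?_
  obtain ⟨s, h3, h4⟩ := (h2.and (h.eventually_fwd_mem h0 h1 hlo hhi)).exists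
  exact h3 h4

theorem IsBox.bwdOut_eq_zero (h : G.IsBox S lo hi) (h0 : 0 < t) (h1 : t ≤ G.len e)
    (hlo : lo e < t) (hhi : t ≤ hi e) : G.bwdOut (G.box S lo hi) e t = 0 := by
  refine if_neg fun h2 => ?_
  obtain ⟨s, h3, h4⟩ := (h2.and (h.eventually_bwd_mem h0 h1 hlo hhi)).exists
  exact h3 h4

theorem IsReduced.exists_lt_outdeg [Fintype E] {D : G.Divisor} {q : G.Point}
    (hD : IsReduced D q) (h : G.IsBox S lo hi) (hne : (G.box S lo hi).Nonempty)
    (hq : q ∉ G.box S lo hi) :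
    ∃ x ∈ G.box S lo hi, 0 ≤ D x ∧ D x < G.outdeg (G.box S lo hi) x := by
  obtain ⟨x, hx, hlt⟩ := hD.2 _ h.isClosedSubgraph hne hq
  exact ⟨x, hx, hD.1 x (by rintro rfl; exact hq hx), hlt⟩

/-- A reduced divisor does not have two chips in the interior of the same edge. -/
theorem IsReduced.not_two_chips [Fintype E] {D : G.Divisor} {v : V}
    (hD : IsReduced D (.vertex v)) {a b : ℝ} (ha : 0 < a) (hab : a ≤ b) (hb : b < G.len e)
    (hDa : 1 ≤ D (G.pt e a)) (hDb : 1 ≤ D (G.pt e b)) (h2 : a = b → 2 ≤ D (G.pt e a)) :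
    False := by
  classical
  -- The test set is the segment `[a, b]` of `e`. The bounds `1` and `0` on the other edges stand
  -- for the empty interval.
  have hbox : G.IsBox ∅ (fun e' => if e' = e then a else 1) (fun e' => if e' = e then b else 0) := by
    constructor
    · intro e'
      by_cases he : e' = e
      · simp [he, ha]
      · simp [he]
    · intro e'
      by_cases he : e' = e
      · simp [he, hb]
      · have := G.len_pos e'
        simp [he]
        intro _
        exact this
  obtain ⟨x, hx, -, hlt⟩ := hD.exists_lt_outdeg hbox
    ⟨G.pt e a, by rw [hbox.pt_mem ha.le (hab.trans hb.le)]; simp [hab]⟩ (fun h => h.elim)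
  cases x with
  | vertex w => exact hx.elim
  | inner e' t h0 h1 =>
    rw [outdeg_inner] at hlt
    obtain ⟨h3, h4⟩ := hx
    by_cases he : e' = e
    · subst he
      simp only [if_true] at h3 h4
      have f1 := fwdOut_le_one (G.box ∅ (fun f => if f = e' then a else 1)
        (fun f => if f = e' then b else 0)) e' t
      have f2 := bwdOut_le_one (G.box ∅ (fun f => if f = e' then a else 1)
        (fun f => if f = e' then b else 0)) e' t
      rw [← pt_inner h0 h1] at hlt
      rcases h3.eq_or_lt with rfl | h3
      · rcases h4.eq_or_lt with rfl | h4
        · have := h2 rfl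
          linarith
        · rw [hbox.fwdOut_eq_zero h0.le h1 (by simp) (by simpa using h4)] at hlt
          linarith
      · rw [hbox.bwdOut_eq_zero h0 h1.le (by simpa using h3) (by simpa using h4)] at hlt
        rcases h4.eq_or_lt with rfl | h4
        · linarith
        · rw [hbox.fwdOut_eq_zero h0.le h1 (by simpa using h3.le) (by simpa using h4)] at hlt
          have := hD.1 (G.pt e' t) (by rw [pt_inner h0 h1]; simp)
          linarith
    · simp only [he, if_false] at h3 h4
      linarith

end Box

end MetricGraph

/-! ### Directions at the vertices of a chain of loops. -/

namespace ChainOfLoops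

variable {g : ℕ}

theorem sum_edges (F : Edge g → ℤ) :
    ∑ e, F e = ∑ j, F (.bridge j) + (∑ k, F (.top k) + ∑ k, F (.bot k)) := by
  rw [← (edgeEquiv g).sum_comp, Fintype.sum_sum_type, Fintype.sum_sum_type]
  rfl

section SumDirections

variable (Γ : ChainOfLoops g) (fwd bwd : Edge g → ℝ → ℤ)

theorem sumDirections_w_zero :
    Γ.graph.sumDirections fwd bwd (.vertex (.w 0)) = fwd (.bridge 0) 0 := by
  classical
  simp [MetricGraph.sumDirections, sum_edges, graph, Fin.succ_ne_zero]

theorem sumDirections_w_succ (k : Fin g) :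
    Γ.graph.sumDirections fwd bwd (.vertex (.w k.succ)) =
      fwd (.bridge k.succ) 0 + (bwd (.top k) (Γ.top k) + bwd (.bot k) (Γ.bot k)) := by
  classical
  simp [MetricGraph.sumDirections, sum_edges, graph]

theorem sumDirections_v_castSucc (k : Fin g) :
    Γ.graph.sumDirections fwd bwd (.vertex (.v k.castSucc)) =
      bwd (.bridge k.castSucc) (Γ.bridge k.castSucc) + (fwd (.top k) 0 + fwd (.bot k) 0) := by
  classical
  simp [MetricGraph.sumDirections, sum_edges, graph]

theorem sumDirections_v_last :
    Γ.graph.sumDirections fwd bwd (.vertex (.v (Fin.last g))) =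
      bwd (.bridge (Fin.last g)) (Γ.bridge (Fin.last g)) := by
  classical
  simp [MetricGraph.sumDirections, sum_edges, graph, Fin.castSucc_ne_last]

end SumDirections

end ChainOfLoops

/-! ### Where a reduced divisor has no chips. -/

namespace ChainOfLoops

variable {g : ℕ} {Γ : ChainOfLoops g} {D : Γ.graph.Divisor}

open MetricGraph

/-- A divisor that is reduced with respect to the left end has no chips on the bridges, except at
their left ends. -/
theorem bridge_eq_zero_of_isReduced (hD : IsReduced D Γ.leftEnd) (j : Fin (g + 1)) {t : ℝ}
    (h0 : 0 < t) (h1 : t ≤ Γ.bridge j) : D (Γ.graph.pt (.bridge j) t) = 0 := by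
  -- The test set is everything from the point `t` of the bridge `j` to the right. The only
  -- direction that leaves it is the one to the left at that point, so a chip there would contradict
  -- reducedness.
  set S : Set (Vertex g) := {x | match x with | .w i => j < i | .v i => j ≤ i} with hS
  set lo : Edge g → ℝ := fun e => match e with
    | .bridge i => if i < j then 1 else if i = j then t else 0
    | .top k => if k.castSucc < j then 1 else 0
    | .bot k => if k.castSucc < j then 1 else 0 with hlo
  set hi : Edge g → ℝ := fun e => match e with
    | .bridge i => if i < j then 0 else Γ.bridge i
    | .top k => if k.castSucc < j then 0 else Γ.top k
    | .bot k => if k.castSucc < j then 0 else Γ.bot k with hhi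
  have hbox : Γ.graph.IsBox S lo hi := by
    constructor
    · rintro (i | k | k)
      · have := Γ.bridge_pos i
        rcases lt_trichotomy i j with h | rfl | h
        · simp [hS, hlo, graph, h, h.not_gt, (zero_lt_one' ℝ).not_ge]
        · simp [hS, hlo, graph, h0]
        · simp [hS, hlo, hhi, graph, h, h.not_gt, h.ne', this.le]
      · have := Γ.top_pos k
        rcases lt_or_ge k.castSucc j with h | h
        · simp [hS, hlo, hhi, graph, h, h.not_ge, (zero_lt_one' ℝ).not_ge]
        · simp [hS, hlo, hhi, graph, h, h.not_gt, this.le]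
      · have := Γ.bot_pos k
        rcases lt_or_ge k.castSucc j with h | h
        · simp [hS, hlo, hhi, graph, h, h.not_ge, (zero_lt_one' ℝ).not_ge]
        · simp [hS, hlo, hhi, graph, h, h.not_gt, this.le]
    · rintro (i | k | k)
      · have := Γ.bridge_pos i
        rcases lt_trichotomy i j with h | rfl | h
        · simp [hS, hhi, graph, h, h.not_ge, this.not_ge]
        · simp [hS, hlo, hhi, graph, h1]
        · simp [hS, hlo, hhi, graph, h.not_gt, h.ne', h.le, this.le]
      · have := Γ.top_pos k
        rcases lt_or_ge k.castSucc j with h | h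
        · have h' : ¬ j < k.succ := by rw [Fin.lt_def] at *; simp at *; omega
          simp [hS, hlo, hhi, graph, h, h', this]
        · have h' : j < k.succ := by rw [Fin.lt_def]; rw [Fin.le_def] at h; simp at *; omega
          simp [hS, hlo, hhi, graph, h.not_gt, h', this.le]
      · have := Γ.bot_pos k
        rcases lt_or_ge k.castSucc j with h | h
        · have h' : ¬ j < k.succ := by rw [Fin.lt_def] at *; simp at *; omega
          simp [hS, hlo, hhi, graph, h, h', this]
        · have h' : j < k.succ := by rw [Fin.lt_def]; rw [Fin.le_def] at h; simp at *; omega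
          simp [hS, hlo, hhi, graph, h.not_gt, h', this.le]
  have hq : Γ.leftEnd ∉ Γ.graph.box S lo hi := fun h : j < 0 => absurd h (Fin.not_lt_zero j)
  have ht : Γ.graph.pt (.bridge j) t ∈ Γ.graph.box S lo hi := by
    exact (hbox.pt_mem (e := Edge.bridge j) h0.le h1).2 (by simp [hlo, hhi, h1])
  have hDt : 0 ≤ D (Γ.graph.pt (.bridge j) t) := hD.1 _ fun h => hq (h ▸ ht)
  obtain ⟨x, hx, hx0, hlt⟩ := hD.exists_lt_outdeg hbox ⟨_, ht⟩ hq
  have loop0 : ∀ k : Fin g, j ≤ k.castSucc →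
      Γ.graph.fwdOut (Γ.graph.box S lo hi) (.top k) 0 = 0 ∧
      Γ.graph.fwdOut (Γ.graph.box S lo hi) (.bot k) 0 = 0 ∧
      Γ.graph.bwdOut (Γ.graph.box S lo hi) (.top k) (Γ.top k) = 0 ∧
      Γ.graph.bwdOut (Γ.graph.box S lo hi) (.bot k) (Γ.bot k) = 0 := by
    intro k hk
    have t0 := Γ.top_pos k
    have b0 := Γ.bot_pos k
    refine ⟨hbox.fwdOut_eq_zero le_rfl t0 ?_ ?_, hbox.fwdOut_eq_zero le_rfl b0 ?_ ?_,
      hbox.bwdOut_eq_zero t0 le_rfl ?_ ?_, hbox.bwdOut_eq_zero b0 le_rfl ?_ ?_⟩ <;>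
    simp [hlo, hhi, hk.not_gt, t0, b0]
  have bridge0 : ∀ (i : Fin (g + 1)) (s : ℝ), j ≤ i → 0 < s → s ≤ Γ.bridge i →
      (i = j → t < s) → Γ.graph.bwdOut (Γ.graph.box S lo hi) (.bridge i) s = 0 := by
    intro i s hi' hs0 hs1 hts
    refine hbox.bwdOut_eq_zero hs0 hs1 ?_ ?_
    · by_cases hij : i = j
      · simp [hlo, hij, hts hij]
      · simp [hlo, hij, hi'.not_gt, hs0]
    · simp [hhi, hi'.not_gt, hs1]
  have bridge1 : ∀ (i : Fin (g + 1)) (s : ℝ), j ≤ i → 0 ≤ s → s < Γ.bridge i →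
      (i = j → t ≤ s) → Γ.graph.fwdOut (Γ.graph.box S lo hi) (.bridge i) s = 0 := by
    intro i s hi' hs0 hs1 hts
    refine hbox.fwdOut_eq_zero hs0 hs1 ?_ ?_
    · by_cases hij : i = j
      · simp [hlo, hij, hts hij]
      · simp [hlo, hij, hi'.not_gt, hs0]
    · simp [hhi, hi'.not_gt, hs1]
  cases x with
  | vertex x =>
    rw [outdeg_eq] at hlt
    cases x with
    | w i =>
      exfalso
      have hji : j < i := hx
      obtain ⟨k, rfl⟩ := Fin.exists_succ_eq.2 (Fin.pos_iff_ne_zero.1 ((Fin.zero_le j).trans_lt hji))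
      obtain ⟨-, -, h3, h4⟩ := loop0 k (by rw [Fin.lt_def] at hji; rw [Fin.le_def]; simp at *; omega)
      rw [sumDirections_w_succ, h3, h4, bridge1 _ 0 hji.le le_rfl (Γ.bridge_pos _)
        (fun h => absurd h hji.ne')] at hlt
      linarith
    | v i =>
      have hji : j ≤ i := hx
      have hlt' : D (.vertex (.v i)) <
          Γ.graph.bwdOut (Γ.graph.box S lo hi) (.bridge i) (Γ.bridge i) := by
        rcases Fin.eq_castSucc_or_eq_last i with ⟨k, rfl⟩ | rfl
        · obtain ⟨h1, h2, -, -⟩ := loop0 k hji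
          rw [sumDirections_v_castSucc, h1, h2] at hlt
          simpa using hlt
        · rwa [sumDirections_v_last] at hlt
      by_cases h : i = j ∧ t = Γ.bridge i
      · obtain ⟨rfl, rfl⟩ := h
        have := bwdOut_le_one (Γ.graph.box S lo hi) (.bridge i) (Γ.bridge i)
        have h5 : Γ.graph.pt (.bridge i) (Γ.bridge i) = .vertex (.v i) :=
          pt_len Γ.graph (.bridge i)
        rw [h5] at hDt ⊢
        linarith
      · rw [bridge0 i _ hji (Γ.bridge_pos i) le_rfl] at hlt'
        · linarith
        · rintro rfl
          exact lt_of_le_of_ne h1 fun h' => h ⟨rfl, h'⟩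
  | inner e s h2 h3 =>
    rw [outdeg_inner] at hlt
    obtain ⟨h4, h5⟩ := hx
    cases e with
    | bridge i =>
      have hji : j ≤ i := by
        by_contra hij
        simp only [hlo, hhi, not_le.1 hij, if_true] at h4 h5
        linarith
      have hts : i = j → t ≤ s := by
        rintro rfl
        simpa [hlo] using h4
      rw [bridge1 i s hji h2.le h3 hts] at hlt
      by_cases h : i = j ∧ t = s
      · obtain ⟨rfl, rfl⟩ := h
        have := bwdOut_le_one (Γ.graph.box S lo hi) (.bridge i) t
        rw [← pt_inner h2 h3] at hlt
        linarith
      · rw [bridge0 i s hji h2 h3.le fun h' => lt_of_le_of_ne (hts h') fun h'' => h ⟨h', h''⟩] at hlt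
        linarith
    | top k =>
      exfalso
      have hjk : ¬ k.castSucc < j := by
        intro h
        simp only [hlo, hhi, h, if_true] at h4 h5
        linarith
      rw [hbox.fwdOut_eq_zero h2.le h3, hbox.bwdOut_eq_zero h2 h3.le] at hlt
      · linarith
      · simp [hlo, hjk, h2]
      · exact h5
      · exact h4
      · simp only [hhi, hjk, if_false]; exact h3
    | bot k =>
      exfalso
      have hjk : ¬ k.castSucc < j := by
        intro h
        simp only [hlo, hhi, h, if_true] at h4 h5
        linarith
      rw [hbox.fwdOut_eq_zero h2.le h3, hbox.bwdOut_eq_zero h2 h3.le] at hlt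
      · linarith
      · simp [hlo, hjk, h2]
      · exact h5
      · exact h4
      · simp only [hhi, hjk, if_false]; exact h3

theorem v_eq_zero_of_isReduced (hD : IsReduced D Γ.leftEnd) (j : Fin (g + 1)) :
    D (.vertex (.v j)) = 0 := by
  have h := bridge_eq_zero_of_isReduced hD j (Γ.bridge_pos j) le_rfl
  rwa [show Γ.graph.pt (.bridge j) (Γ.bridge j) = .vertex (.v j) from
    pt_len Γ.graph (.bridge j)] at h

/-- A divisor that is reduced with respect to the left end does not have a chip on both edges of the
same loop. -/
theorem not_chip_on_both_edges (hD : IsReduced D Γ.leftEnd) (k : Fin g) {a b : ℝ}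
    (ha0 : 0 < a) (ha1 : a ≤ Γ.bot k) (hb0 : 0 < b) (hb1 : b ≤ Γ.top k)
    (hDa : 1 ≤ D (Γ.graph.pt (.bot k) a)) (hDb : 1 ≤ D (Γ.graph.pt (.top k) b))
    (hab : ¬ (a = Γ.bot k ∧ b = Γ.top k)) : False := by
  -- The test set is everything to the right of the two chips, which are included. Exactly two
  -- directions leave it, one at each chip; `hab` ensures that these are different points.
  set S : Set (Vertex g) :=
    {x | match x with | .w i => k.castSucc < i | .v i => k.castSucc < i} with hS
  set lo : Edge g → ℝ := fun e => match e with
    | .bridge i => if k.castSucc < i then 0 else 1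
    | .top l => if l < k then 1 else if l = k then b else 0
    | .bot l => if l < k then 1 else if l = k then a else 0 with hlo
  set hi : Edge g → ℝ := fun e => match e with
    | .bridge i => if k.castSucc < i then Γ.bridge i else 0
    | .top l => if l < k then 0 else Γ.top l
    | .bot l => if l < k then 0 else Γ.bot l with hhi
  have hbox : Γ.graph.IsBox S lo hi := by
    constructor
    · rintro (i | l | l)
      · have := Γ.bridge_pos i
        by_cases h : k.castSucc < i
        · simp [hS, hlo, hhi, graph, h, this.le]
        · simp [hS, hlo, hhi, graph, h]
      · have := Γ.top_pos l
        rcases lt_trichotomy l k with h | rfl | h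
        · simp [hS, hlo, graph, h, h.not_gt, (zero_lt_one' ℝ).not_ge]
        · simp [hS, hlo, graph, hb0]
        · simp [hS, hlo, hhi, graph, h, h.not_gt, h.ne', this.le]
      · have := Γ.bot_pos l
        rcases lt_trichotomy l k with h | rfl | h
        · simp [hS, hlo, graph, h, h.not_gt, (zero_lt_one' ℝ).not_ge]
        · simp [hS, hlo, graph, ha0]
        · simp [hS, hlo, hhi, graph, h, h.not_gt, h.ne', this.le]
    · rintro (i | l | l)
      · have := Γ.bridge_pos i
        by_cases h : k.castSucc < i
        · simp [hS, hlo, hhi, graph, h, this.le]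
        · simp [hS, hlo, hhi, graph, h, this]
      · have := Γ.top_pos l
        have h' : k.castSucc < l.succ ↔ k ≤ l := Fin.castSucc_lt_succ_iff
        rcases lt_trichotomy l k with h | rfl | h
        · simp [hS, hhi, graph, h, h', h.not_ge, this.not_ge]
        · simp [hS, hlo, hhi, graph, hb1]
        · simp [hS, hlo, hhi, graph, h', h.not_gt, h.ne', h.le, this.le]
      · have := Γ.bot_pos l
        have h' : k.castSucc < l.succ ↔ k ≤ l := Fin.castSucc_lt_succ_iff
        rcases lt_trichotomy l k with h | rfl | h
        · simp [hS, hhi, graph, h, h', h.not_ge, this.not_ge]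
        · simp [hS, hlo, hhi, graph, ha1]
        · simp [hS, hlo, hhi, graph, h', h.not_gt, h.ne', h.le, this.le]
  have hq : Γ.leftEnd ∉ Γ.graph.box S lo hi :=
    fun h : k.castSucc < 0 => absurd h (Fin.not_lt_zero _)
  have hne : Γ.graph.pt (.bot k) a ∈ Γ.graph.box S lo hi := by
    exact (hbox.pt_mem (e := Edge.bot k) ha0.le ha1).2 (by simp [hlo, hhi, ha1])
  obtain ⟨x, hx, hx0, hlt⟩ := hD.exists_lt_outdeg hbox ⟨_, hne⟩ hq
  have bridge0 : ∀ (i : Fin (g + 1)) (s : ℝ), k.castSucc < i → 0 < s → s ≤ Γ.bridge i →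
      Γ.graph.bwdOut (Γ.graph.box S lo hi) (.bridge i) s = 0 := by
    intro i s hi' hs0 hs1
    refine hbox.bwdOut_eq_zero hs0 hs1 ?_ ?_ <;> simp [hlo, hhi, hi', hs0, hs1]
  have bridge1 : ∀ (i : Fin (g + 1)) (s : ℝ), k.castSucc < i → 0 ≤ s → s < Γ.bridge i →
      Γ.graph.fwdOut (Γ.graph.box S lo hi) (.bridge i) s = 0 := by
    intro i s hi' hs0 hs1
    refine hbox.fwdOut_eq_zero hs0 hs1 ?_ ?_ <;> simp [hlo, hhi, hi', hs0, hs1]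
  have top0 : ∀ (l : Fin g) (s : ℝ), k ≤ l → 0 < s → s ≤ Γ.top l → (l = k → b < s) →
      Γ.graph.bwdOut (Γ.graph.box S lo hi) (.top l) s = 0 := by
    intro l s hl hs0 hs1 hbs
    refine hbox.bwdOut_eq_zero hs0 hs1 ?_ ?_
    · by_cases h : l = k
      · simp [hlo, h, hbs h]
      · simp [hlo, h, hl.not_gt, hs0]
    · simp [hhi, hl.not_gt, hs1]
  have bot0 : ∀ (l : Fin g) (s : ℝ), k ≤ l → 0 < s → s ≤ Γ.bot l → (l = k → a < s) →
      Γ.graph.bwdOut (Γ.graph.box S lo hi) (.bot l) s = 0 := by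
    intro l s hl hs0 hs1 hbs
    refine hbox.bwdOut_eq_zero hs0 hs1 ?_ ?_
    · by_cases h : l = k
      · simp [hlo, h, hbs h]
      · simp [hlo, h, hl.not_gt, hs0]
    · simp [hhi, hl.not_gt, hs1]
  have top1 : ∀ (l : Fin g) (s : ℝ), k ≤ l → 0 ≤ s → s < Γ.top l → (l = k → b ≤ s) →
      Γ.graph.fwdOut (Γ.graph.box S lo hi) (.top l) s = 0 := by
    intro l s hl hs0 hs1 hbs
    refine hbox.fwdOut_eq_zero hs0 hs1 ?_ ?_
    · by_cases h : l = k
      · simp [hlo, h, hbs h]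
      · simp [hlo, h, hl.not_gt, hs0]
    · simp [hhi, hl.not_gt, hs1]
  have bot1 : ∀ (l : Fin g) (s : ℝ), k ≤ l → 0 ≤ s → s < Γ.bot l → (l = k → a ≤ s) →
      Γ.graph.fwdOut (Γ.graph.box S lo hi) (.bot l) s = 0 := by
    intro l s hl hs0 hs1 hbs
    refine hbox.fwdOut_eq_zero hs0 hs1 ?_ ?_
    · by_cases h : l = k
      · simp [hlo, h, hbs h]
      · simp [hlo, h, hl.not_gt, hs0]
    · simp [hhi, hl.not_gt, hs1]
  cases x with
  | vertex x =>
    rw [outdeg_eq] at hlt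
    cases x with
    | w i =>
      have hi' : k.castSucc < i := hx
      obtain ⟨l, rfl⟩ := Fin.exists_succ_eq.2 (Fin.pos_iff_ne_zero.1 ((Fin.zero_le _).trans_lt hi'))
      have hl : k ≤ l := Fin.castSucc_lt_succ_iff.1 hi'
      rw [sumDirections_w_succ, bridge1 _ 0 hi' le_rfl (Γ.bridge_pos _)] at hlt
      have e1 : Γ.graph.pt (.bot l) (Γ.bot l) = .vertex (.w l.succ) := pt_len Γ.graph (.bot l)
      have e2 : Γ.graph.pt (.top l) (Γ.top l) = .vertex (.w l.succ) := pt_len Γ.graph (.top l)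
      have f1 := bwdOut_le_one (Γ.graph.box S lo hi) (.bot l) (Γ.bot l)
      have f2 := bwdOut_le_one (Γ.graph.box S lo hi) (.top l) (Γ.top l)
      by_cases h1 : l = k ∧ a = Γ.bot k
      · obtain ⟨rfl, rfl⟩ := h1
        rw [top0 l _ le_rfl (Γ.top_pos l) le_rfl
          fun _ => lt_of_le_of_ne hb1 fun h' => hab ⟨rfl, h'⟩] at hlt
        rw [e1] at hDa
        linarith
      · rw [bot0 l _ hl (Γ.bot_pos l) le_rfl (by
          rintro rfl; exact lt_of_le_of_ne ha1 fun h' => h1 ⟨rfl, h'⟩)] at hlt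
        by_cases h2 : l = k ∧ b = Γ.top k
        · obtain ⟨rfl, rfl⟩ := h2
          rw [e2] at hDb
          linarith
        · rw [top0 l _ hl (Γ.top_pos l) le_rfl (by
            rintro rfl; exact lt_of_le_of_ne hb1 fun h' => h2 ⟨rfl, h'⟩)] at hlt
          linarith
    | v i =>
      have hi' : k.castSucc < i := hx
      rcases Fin.eq_castSucc_or_eq_last i with ⟨l, rfl⟩ | rfl
      · have hl : k < l := hi'
        rw [sumDirections_v_castSucc, bridge0 _ _ hi' (Γ.bridge_pos _) le_rfl,
          top1 l 0 hl.le le_rfl (Γ.top_pos l) fun h => absurd h hl.ne',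
          bot1 l 0 hl.le le_rfl (Γ.bot_pos l) fun h => absurd h hl.ne'] at hlt
        linarith
      · rw [sumDirections_v_last, bridge0 _ _ hi' (Γ.bridge_pos _) le_rfl] at hlt
        linarith
  | inner e s h2 h3 =>
    rw [outdeg_inner] at hlt
    obtain ⟨h4, h5⟩ := hx
    cases e with
    | bridge i =>
      have hi' : k.castSucc < i := by
        by_contra h
        simp only [hlo, hhi, h, if_false] at h4 h5
        linarith
      rw [bridge0 i s hi' h2 h3.le, bridge1 i s hi' h2.le h3] at hlt
      linarith
    | top l =>
      have hl : k ≤ l := by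
        by_contra h
        simp only [hlo, hhi, not_le.1 h, if_true] at h4 h5
        linarith
      have hbs : l = k → b ≤ s := by
        rintro rfl
        simpa [hlo] using h4
      rw [top1 l s hl h2.le h3 hbs] at hlt
      by_cases h : l = k ∧ b = s
      · obtain ⟨rfl, rfl⟩ := h
        have := bwdOut_le_one (Γ.graph.box S lo hi) (.top l) b
        rw [← pt_inner h2 h3] at hlt
        linarith
      · rw [top0 l s hl h2 h3.le fun h' => lt_of_le_of_ne (hbs h') fun h'' => h ⟨h', h''⟩] at hlt
        linarith
    | bot l =>
      have hl : k ≤ l := by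
        by_contra h
        simp only [hlo, hhi, not_le.1 h, if_true] at h4 h5
        linarith
      have hbs : l = k → a ≤ s := by
        rintro rfl
        simpa [hlo] using h4
      rw [bot1 l s hl h2.le h3 hbs] at hlt
      by_cases h : l = k ∧ a = s
      · obtain ⟨rfl, rfl⟩ := h
        have := bwdOut_le_one (Γ.graph.box S lo hi) (.bot l) a
        rw [← pt_inner h2 h3] at hlt
        linarith
      · rw [bot0 l s hl h2 h3.le fun h' => lt_of_le_of_ne (hbs h') fun h'' => h ⟨h', h''⟩] at hlt
        linarith

end ChainOfLoops

/-! ### Reduced divisors have at most one chip on each loop. -/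

namespace ChainOfLoops

variable {g : ℕ} {Γ : ChainOfLoops g} {D : Γ.graph.Divisor}

open MetricGraph

theorem loopPoint_of_le {k : Fin g} {x : ℝ} (h : x ≤ Γ.bot k) :
    Γ.loopPoint k x = Γ.graph.pt (.bot k) x := if_pos h

theorem loopPoint_of_lt {k : Fin g} {x : ℝ} (h : Γ.bot k < x) :
    Γ.loopPoint k x = Γ.graph.pt (.top k) (Γ.circ k - x) := if_neg h.not_ge

theorem loopPoint_of_ge {k : Fin g} {x : ℝ} (h : Γ.bot k ≤ x) :
    Γ.loopPoint k x = Γ.graph.pt (.top k) (Γ.circ k - x) := by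
  rcases h.eq_or_lt with rfl | h
  · rw [loopPoint_of_le le_rfl, circ, add_sub_cancel_right]
    exact (pt_len Γ.graph (.bot k)).trans (pt_len Γ.graph (.top k)).symm
  · exact loopPoint_of_lt h

/-- If the chips are not inside one edge, then the first is on the bottom edge and the second on the
top edge. Either may be at the common right vertex, but not both, as `x < y`. -/
theorem loopPoint_chip_unique (hD : IsReduced D Γ.leftEnd) {k : Fin g} {x y : ℝ}
    (h0 : 0 < x) (hxy : x < y) (h1 : y < Γ.circ k) (hx : 1 ≤ D (Γ.loopPoint k x))
    (hy : 1 ≤ D (Γ.loopPoint k y)) : False := by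
  have hc : Γ.circ k = Γ.top k + Γ.bot k := rfl
  rcases lt_or_ge y (Γ.bot k) with h | h
  · rw [loopPoint_of_le (hxy.trans h).le] at hx
    rw [loopPoint_of_le h.le] at hy
    exact hD.not_two_chips (e := Edge.bot k) h0 hxy.le h hx hy fun h' => absurd h' hxy.ne
  rw [loopPoint_of_ge h] at hy
  rcases lt_or_ge (Γ.bot k) x with h' | h'
  · rw [loopPoint_of_lt h'] at hx
    refine hD.not_two_chips (G := Γ.graph) (e := Edge.top k) (a := Γ.circ k - y)
      (b := Γ.circ k - x) (by linarith) (by linarith)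
      (show Γ.circ k - x < Γ.top k by linarith) hy hx fun h' => ?_
    linarith
  · rw [loopPoint_of_le h'] at hx
    refine not_chip_on_both_edges hD k h0 h' (by linarith) (by linarith) hx hy fun h2 => ?_
    linarith [h2.1, h2.2]

theorem chipPos_cases (Γ : ChainOfLoops g) (D : Γ.graph.Divisor) (k : Fin g) :
    (0 < Γ.chipPos D k ∧ Γ.chipPos D k < Γ.circ k ∧ D (Γ.loopPoint k (Γ.chipPos D k)) ≠ 0) ∨
    (Γ.chipPos D k = 0 ∧ ∀ x, 0 < x → x < Γ.circ k → D (Γ.loopPoint k x) = 0) := by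
  unfold chipPos
  split_ifs with h
  · exact .inl h.choose_spec
  · push Not at h
    exact .inr ⟨rfl, h⟩

/-- A divisor whose chips away from the left end are at the counterclockwise distances `x k` on
the loops, one for every loop with `x k ≠ 0`. -/
structure HasLoopChips (D : Γ.graph.Divisor) (x : Fin g → ℝ) : Prop where
  nonneg : ∀ k, 0 ≤ x k
  lt_circ : ∀ k, x k < Γ.circ k
  ne_bot : ∀ k, x k ≠ Γ.bot k
  bridge : ∀ j t, 0 < t → t < Γ.bridge j → D (Γ.graph.pt (.bridge j) t) = 0
  v : ∀ j, D (.vertex (.v j)) = 0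
  w : ∀ k : Fin g, D (.vertex (.w k.succ)) = 0
  bot : ∀ k t, 0 < t → t < Γ.bot k → D (Γ.graph.pt (.bot k) t) = if t = x k then 1 else 0
  top : ∀ k t, 0 < t → t < Γ.top k →
    D (Γ.graph.pt (.top k) t) = if t = Γ.circ k - x k then 1 else 0

theorem hasLoopChips_of_isReduced (hD : IsReduced D Γ.leftEnd)
    (hbot : ∀ k, Γ.chipPos D k ≠ Γ.bot k) : HasLoopChips D (Γ.chipPos D) := by
  have hnonneg : ∀ e t, 0 < t → t < Γ.graph.len e → 0 ≤ D (Γ.graph.pt e t) := by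
    intro e t h0 h1
    refine hD.1 _ ?_
    rw [pt_inner h0 h1]
    simp [leftEnd]
  have hle : ∀ e t, 0 < t → t < Γ.graph.len e → D (Γ.graph.pt e t) ≤ 1 := by
    intro e t h0 h1
    by_contra h
    exact hD.not_two_chips h0 le_rfl h1 (by linarith) (by linarith) fun _ => by linarith
  have hwnonneg : ∀ k : Fin g, 0 ≤ D (.vertex (.w k.succ)) := by
    refine fun k => hD.1 _ ?_
    simp [leftEnd, Fin.succ_ne_zero]
  have hc : ∀ k, Γ.circ k = Γ.top k + Γ.bot k := fun k => rfl
  have hlp : ∀ k x, 0 < x → x < Γ.circ k → 0 ≤ D (Γ.loopPoint k x) := by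
    intro k x h0 h1
    rcases lt_trichotomy x (Γ.bot k) with h | rfl | h
    · rw [loopPoint_of_le h.le]; exact hnonneg _ _ h0 h
    · rw [loopPoint_of_le le_rfl,
        show Γ.graph.pt (.bot k) (Γ.bot k) = .vertex (.w k.succ) from pt_len Γ.graph (.bot k)]
      exact hwnonneg k
    · rw [loopPoint_of_lt h]
      exact hnonneg _ _ (by linarith) (show Γ.circ k - x < Γ.top k by linarith [hc k])
  have hzero : ∀ k x, 0 < x → x < Γ.circ k → x ≠ Γ.chipPos D k → D (Γ.loopPoint k x) = 0 := by
    intro k x h0 h1 hx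
    rcases chipPos_cases Γ D k with ⟨h2, h3, h4⟩ | ⟨-, h⟩
    · by_contra hne
      have h5 : 1 ≤ D (Γ.loopPoint k x) := by have := hlp k x h0 h1; omega
      have h6 : 1 ≤ D (Γ.loopPoint k (Γ.chipPos D k)) := by have := hlp k _ h2 h3; omega
      rcases hx.lt_or_gt with h | h
      · exact loopPoint_chip_unique hD h0 h h3 h5 h6
      · exact loopPoint_chip_unique hD h2 h h1 h6 h5
    · exact h x h0 h1
  have hpos : ∀ k, 0 < Γ.chipPos D k → D (Γ.loopPoint k (Γ.chipPos D k)) = 1 := by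
    intro k hk
    rcases chipPos_cases Γ D k with ⟨h2, h3, h4⟩ | ⟨h, -⟩
    · have h5 := hlp k _ h2 h3
      have h6 : D (Γ.loopPoint k (Γ.chipPos D k)) ≤ 1 := by
        rcases (hbot k).lt_or_gt with h | h
        · rw [loopPoint_of_le h.le]; exact hle _ _ h2 h
        · rw [loopPoint_of_lt h]
          exact hle _ _ (by linarith) (show _ < Γ.top k by linarith [hc k])
      omega
    · exact absurd h hk.ne'
  have hcirc : ∀ k, 0 ≤ Γ.chipPos D k ∧ Γ.chipPos D k < Γ.circ k := by
    intro k
    rcases chipPos_cases Γ D k with ⟨h2, h3, h4⟩ | ⟨h, -⟩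
    · exact ⟨h2.le, h3⟩
    · rw [h, hc]
      exact ⟨le_rfl, add_pos (Γ.top_pos k) (Γ.bot_pos k)⟩
  refine ⟨fun k => (hcirc k).1, fun k => (hcirc k).2, hbot,
    fun j t h0 h1 => bridge_eq_zero_of_isReduced hD j h0 h1.le, v_eq_zero_of_isReduced hD, ?_, ?_, ?_⟩
  · intro k
    have := hzero k (Γ.bot k) (Γ.bot_pos k) (by linarith [hc k, Γ.top_pos k]) (hbot k).symm
    rwa [loopPoint_of_le le_rfl, show Γ.graph.pt (.bot k) (Γ.bot k) = .vertex (.w k.succ) from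
      pt_len Γ.graph (.bot k)] at this
  · intro k t h0 h1
    rw [← loopPoint_of_le h1.le]
    split_ifs with h
    · subst h; exact hpos k h0
    · exact hzero k t h0 (by linarith [hc k, Γ.top_pos k]) h
  · intro k t h0 h1
    have e : Γ.graph.pt (.top k) t = Γ.loopPoint k (Γ.circ k - t) := by
      rw [loopPoint_of_lt (by linarith [hc k]), sub_sub_cancel]
    rw [e]
    split_ifs with h
    · rw [h, sub_sub_cancel]
      refine hpos k ?_
      linarith [hc k, Γ.bot_pos k]
    · refine hzero k _ (by linarith [hc k, Γ.bot_pos k]) (by linarith) fun h' => h ?_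
      linarith

/-- The number of chips on the loop with index `k`. -/
noncomputable def loopCount (x : Fin g → ℝ) (k : Fin g) : ℤ := if x k = 0 then 0 else 1

/-- The counted chips are at pairwise different points, because `ne_bot` puts those on the loops in
the interiors of edges. -/
theorem HasLoopChips.sum_loopCount_le {x : Fin g → ℝ} (h : HasLoopChips D x)
    (hD : ∀ y, y ≠ Γ.leftEnd → 0 ≤ D y) :
    D Γ.leftEnd + ∑ k, loopCount x k ≤ degree D := by
  classical
  set K : Finset (Fin g) := Finset.univ.filter fun k => x k ≠ 0 with hK
  have hchip : ∀ k ∈ K, D (Γ.loopPoint k (x k)) = 1 ∧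
      ((∃ t h0 h1, Γ.loopPoint k (x k) = .inner (.bot k) t h0 h1) ∨
        ∃ t h0 h1, Γ.loopPoint k (x k) = .inner (.top k) t h0 h1) := by
    intro k hk
    have hk0 : 0 < x k := lt_of_le_of_ne (h.nonneg k) (Ne.symm (Finset.mem_filter.1 hk).2)
    have hk1 := h.lt_circ k
    rcases (h.ne_bot k).lt_or_gt with h1 | h1
    · rw [loopPoint_of_le h1.le]
      exact ⟨by simp [h.bot k _ hk0 h1], .inl ⟨_, _, _, pt_inner hk0 h1⟩⟩
    · have h2 : Γ.circ k - x k < Γ.top k := by unfold circ; linarith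
      rw [loopPoint_of_lt h1]
      exact ⟨by simp [h.top k _ (sub_pos.2 hk1) h2],
        .inr ⟨_, _, _, pt_inner (sub_pos.2 hk1) h2⟩⟩
  set P : Fin g → Γ.graph.Point := fun k => Γ.loopPoint k (x k) with hP
  have hinj : Set.InjOn P K := by
    intro k hk l hl hkl
    simp only [hP] at hkl
    rcases (hchip k hk).2 with ⟨t, h0, h1, e⟩ | ⟨t, h0, h1, e⟩ <;>
    rcases (hchip l hl).2 with ⟨t', h0', h1', e'⟩ | ⟨t', h0', h1', e'⟩ <;>
    · rw [e, e'] at hkl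
      simp at hkl
      try exact hkl.1
  have hleft : Γ.leftEnd ∉ K.image P := by
    intro hmem
    obtain ⟨k, hk, hkP⟩ := Finset.mem_image.1 hmem
    simp only [hP] at hkP
    rcases (hchip k hk).2 with ⟨t, h0, h1, e⟩ | ⟨t, h0, h1, e⟩ <;>
    · rw [e] at hkP
      simp [leftEnd] at hkP
  have h1 : ∑ y ∈ insert Γ.leftEnd (K.image P), D y = D Γ.leftEnd + ∑ k, loopCount x k := by
    rw [Finset.sum_insert hleft, Finset.sum_image hinj]
    congr 1
    rw [Finset.sum_congr rfl fun k hk => (hchip k hk).1, hK, Finset.sum_filter]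
    refine Finset.sum_congr rfl fun k _ => ?_
    unfold loopCount
    split_ifs <;> simp_all
  have h2 : degree D = ∑ y ∈ D.support ∪ insert Γ.leftEnd (K.image P), D y := by
    rw [degree, Finsupp.sum]
    refine Finset.sum_subset Finset.subset_union_left fun y _ hy => ?_
    simpa using hy
  rw [← h1, h2]
  refine Finset.sum_le_sum_of_subset_of_nonneg Finset.subset_union_right fun y _ hy => ?_
  refine hD y ?_
  rintro rfl
  exact hy (Finset.mem_insert_self _ _)

/-! ### Slopes of a function that moves `D` to an effective divisor. -/

section Move

variable {D' : Γ.graph.Divisor} {x : Fin g → ℝ} {f : Γ.graph.Point → ℝ}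

/-- The slope of a function at the left end of a bridge. -/
noncomputable def startSlope (Γ : ChainOfLoops g) (f : Γ.graph.Point → ℝ) (j : Fin (g + 1)) : ℤ :=
  Γ.graph.fwdSlope f (.bridge j) 0

/-- The slope of a function at the right end of a bridge. -/
noncomputable def endSlope (Γ : ChainOfLoops g) (f : Γ.graph.Point → ℝ) (j : Fin (g + 1)) : ℤ :=
  -Γ.graph.bwdSlope f (.bridge j) (Γ.bridge j)

/-- A function that moves the chips of `D` to an effective divisor `D'`. -/
structure IsMove (D D' : Γ.graph.Divisor) (f : Γ.graph.Point → ℝ) : Prop where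
  isPL : Γ.graph.IsPL f
  effective : IsEffective D'
  eq_add_div : ∀ y, D' y = D y + Γ.graph.div f y

theorem IsMove.edgeMove_bridge (hf : IsMove D D' f) (hD : HasLoopChips D x) (j : Fin (g + 1)) :
    Γ.graph.IsEdgeMove f (.bridge j) 0 := by
  refine ⟨hf.isPL, fun t h0 h1 => ?_⟩
  have h2 := hf.eq_add_div (Γ.graph.pt (.bridge j) t)
  have h3 := hf.effective (Γ.graph.pt (.bridge j) t)
  rw [hD.bridge j t h0 h1] at h2
  rw [if_neg h0.ne']
  linarith

theorem IsMove.edgeMove_bot (hf : IsMove D D' f) (hD : HasLoopChips D x) (k : Fin g) :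
    Γ.graph.IsEdgeMove f (.bot k) (x k) := by
  refine ⟨hf.isPL, fun t h0 h1 => ?_⟩
  have h2 := hf.eq_add_div (Γ.graph.pt (.bot k) t)
  have h3 := hf.effective (Γ.graph.pt (.bot k) t)
  rw [hD.bot k t h0 h1] at h2
  linarith

theorem IsMove.edgeMove_top (hf : IsMove D D' f) (hD : HasLoopChips D x) (k : Fin g) :
    Γ.graph.IsEdgeMove f (.top k) (Γ.circ k - x k) := by
  refine ⟨hf.isPL, fun t h0 h1 => ?_⟩
  have h2 := hf.eq_add_div (Γ.graph.pt (.top k) t)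
  have h3 := hf.effective (Γ.graph.pt (.top k) t)
  rw [hD.top k t h0 h1] at h2
  linarith

theorem chipCount_bridge (j : Fin (g + 1)) : Γ.graph.chipCount (.bridge j) 0 = 0 := by
  simp [chipCount]

theorem HasLoopChips.chipCount_add (hD : HasLoopChips D x) (k : Fin g) :
    Γ.graph.chipCount (.top k) (Γ.circ k - x k) + Γ.graph.chipCount (.bot k) (x k) =
      loopCount x k := by
  have h0 := hD.nonneg k
  have h1 := hD.lt_circ k
  have e1 : Γ.graph.len (.top k) = Γ.top k := rfl
  have e2 : Γ.graph.len (.bot k) = Γ.bot k := rfl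
  have hc : Γ.circ k = Γ.top k + Γ.bot k := rfl
  have := Γ.bot_pos k
  unfold chipCount loopCount
  rw [e1, e2]
  rcases h0.eq_or_lt with h | h
  · rw [← h, if_neg (by rintro ⟨-, h3⟩; linarith), if_neg (by simp), if_pos rfl, add_zero]
  rw [if_neg h.ne']
  rcases (hD.ne_bot k).lt_or_gt with h2 | h2
  · rw [if_neg (by rintro ⟨-, h3⟩; linarith), if_pos ⟨h, h2⟩, zero_add]
  · rw [if_pos ⟨by linarith, by linarith⟩, if_neg (by rintro ⟨-, h3⟩; linarith), add_zero]

/-- There is no chip of `D` inside a bridge, so `f` is concave there. -/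
theorem IsMove.endSlope_le_startSlope (hf : IsMove D D' f) (hD : HasLoopChips D x)
    (j : Fin (g + 1)) : Γ.endSlope f j ≤ Γ.startSlope f j := by
  have h := (hf.edgeMove_bridge hD j).chipsAfter_nonneg
  rw [chipsAfter, chipCount_bridge] at h
  change 0 ≤ Γ.startSlope f j + Γ.graph.bwdSlope f (.bridge j) (Γ.bridge j) + 0 at h
  unfold endSlope
  linarith

theorem IsMove.sub_eq_of_slopes_eq (hf : IsMove D D' f) (hD : HasLoopChips D x)
    {j : Fin (g + 1)} (h : Γ.endSlope f j = Γ.startSlope f j) {s t : ℝ} (hs : 0 ≤ s)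
    (hst : s ≤ t) (ht : t ≤ Γ.bridge j) :
    f (Γ.graph.pt (.bridge j) t) - f (Γ.graph.pt (.bridge j) s) = Γ.startSlope f j * (t - s) := by
  have n : ∀ t, 0 < t → t < Γ.graph.len (.bridge j) →
      Γ.graph.fwdSlope f (.bridge j) t + Γ.graph.bwdSlope f (.bridge j) t ≤ 0 :=
    fun t h0 h1 => (hf.edgeMove_bridge hD j).slopes_nonpos h0 h1 h0.ne'
  have h1 := hf.isPL.sub_le le_rfl le_rfl n hs hst ht
  have h2 := hf.isPL.le_sub le_rfl le_rfl n hs hst ht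
  have h3 : (-Γ.graph.bwdSlope f (.bridge j) (Γ.graph.len (.bridge j)) : ℝ) = Γ.startSlope f j := by
    rw [← h]; simp [endSlope, graph]
  rw [h3] at h2
  exact le_antisymm h1 h2

theorem IsMove.startSlope_zero (hf : IsMove D D' f) :
    Γ.startSlope f 0 = D Γ.leftEnd - D' Γ.leftEnd := by
  have h := hf.eq_add_div Γ.leftEnd
  rw [leftEnd, div, sumDirections_w_zero] at h
  unfold startSlope leftEnd
  linarith

theorem IsMove.endSlope_last (hf : IsMove D D' f) (hD : HasLoopChips D x) :
    Γ.endSlope f (Fin.last g) = D' Γ.rightEnd := by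
  have h := hf.eq_add_div Γ.rightEnd
  rw [rightEnd, div, sumDirections_v_last, hD.v] at h
  unfold endSlope rightEnd
  linarith

theorem IsMove.v_eq (hf : IsMove D D' f) (hD : HasLoopChips D x) (k : Fin g) :
    D' (.vertex (.v k.castSucc)) = Γ.endSlope f k.castSucc -
      (Γ.graph.fwdSlope f (.top k) 0 + Γ.graph.fwdSlope f (.bot k) 0) := by
  have h := hf.eq_add_div (.vertex (.v k.castSucc))
  rw [div, sumDirections_v_castSucc, hD.v] at h
  unfold endSlope
  linarith

theorem IsMove.w_eq (hf : IsMove D D' f) (hD : HasLoopChips D x) (k : Fin g) :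
    D' (.vertex (.w k.succ)) = -Γ.startSlope f k.succ -
      (Γ.graph.bwdSlope f (.top k) (Γ.top k) + Γ.graph.bwdSlope f (.bot k) (Γ.bot k)) := by
  have h := hf.eq_add_div (.vertex (.w k.succ))
  rw [div, sumDirections_w_succ, hD.w] at h
  unfold startSlope
  linarith

/-- The balance of chips on a loop. -/
theorem IsMove.loop_balance (hf : IsMove D D' f) (hD : HasLoopChips D x) (k : Fin g) :
    D' (.vertex (.v k.castSucc)) + D' (.vertex (.w k.succ)) +
      Γ.graph.chipsAfter f (.top k) (Γ.circ k - x k) + Γ.graph.chipsAfter f (.bot k) (x k) =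
      Γ.endSlope f k.castSucc + loopCount x k - Γ.startSlope f k.succ := by
  have h1 := hf.v_eq hD k
  have h2 := hf.w_eq hD k
  have h3 := hD.chipCount_add k
  have e1 : Γ.graph.len (.top k) = Γ.top k := rfl
  have e2 : Γ.graph.len (.bot k) = Γ.bot k := rfl
  unfold chipsAfter
  rw [e1, e2]
  linarith

theorem IsMove.startSlope_succ_le (hf : IsMove D D' f) (hD : HasLoopChips D x) (k : Fin g) :
    Γ.startSlope f k.succ ≤ Γ.endSlope f k.castSucc + loopCount x k := by
  have h1 := hf.loop_balance hD k
  have h2 := (hf.edgeMove_top hD k).chipsAfter_nonneg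
  have h3 := (hf.edgeMove_bot hD k).chipsAfter_nonneg
  have h4 := hf.effective (.vertex (.v k.castSucc))
  have h5 := hf.effective (.vertex (.w k.succ))
  linarith

/-- In `loop_balance` the slope deficit across the loop is the number of chips of `D'` on it, a sum
of four nonnegative terms. -/
theorem IsMove.eq_zero_of_startSlope_succ_eq (hf : IsMove D D' f) (hD : HasLoopChips D x)
    {k : Fin g} (h : Γ.startSlope f k.succ = Γ.endSlope f k.castSucc + loopCount x k) :
    D' (.vertex (.v k.castSucc)) = 0 ∧ D' (.vertex (.w k.succ)) = 0 ∧
      Γ.graph.chipsAfter f (.top k) (Γ.circ k - x k) = 0 ∧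
      Γ.graph.chipsAfter f (.bot k) (x k) = 0 := by
  have h1 := hf.loop_balance hD k
  have h2 := (hf.edgeMove_top hD k).chipsAfter_nonneg
  have h3 := (hf.edgeMove_bot hD k).chipsAfter_nonneg
  have h4 := hf.effective (.vertex (.v k.castSucc))
  have h5 := hf.effective (.vertex (.w k.succ))
  refine ⟨?_, ?_, ?_, ?_⟩ <;> linarith

/-- If all chips are moved away from a loop, then the position of the chip on the loop is determined
by the slope on the bridge before it. -/
theorem IsMove.modEq_of_startSlope_succ_eq (hf : IsMove D D' f) (hD : HasLoopChips D x)
    {k : Fin g} (h : Γ.startSlope f k.succ = Γ.endSlope f k.castSucc + loopCount x k) :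
    x k ≡ (Γ.endSlope f k.castSucc + loopCount x k : ℤ) * Γ.bot k [PMOD Γ.circ k] := by
  obtain ⟨h1, -, h3, h4⟩ := hf.eq_zero_of_startSlope_succ_eq hD h
  have a1 := (hf.edgeMove_top hD k).sub_eq h3
  have a2 := (hf.edgeMove_bot hD k).sub_eq h4
  rw [pt_len, pt_zero] at a1 a2
  have e1 : Γ.graph.len (.top k) = Γ.top k := rfl
  have e2 : Γ.graph.len (.bot k) = Γ.bot k := rfl
  have e3 : Γ.graph.tgt (.top k) = Γ.graph.tgt (.bot k) := rfl
  have e4 : Γ.graph.src (.top k) = Γ.graph.src (.bot k) := rfl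
  rw [e1, e3, e4] at a1
  rw [e2] at a2
  rw [hf.v_eq hD k] at h1
  have hb : (Γ.endSlope f k.castSucc : ℝ) =
      Γ.graph.fwdSlope f (.top k) 0 + Γ.graph.fwdSlope f (.bot k) 0 := by
    exact_mod_cast sub_eq_zero.1 h1
  have hc : (Γ.graph.chipCount (.top k) (Γ.circ k - x k) : ℝ) +
      Γ.graph.chipCount (.bot k) (x k) = loopCount x k := by exact_mod_cast hD.chipCount_add k
  have hcirc : Γ.circ k = Γ.top k + Γ.bot k := rfl
  -- This treats the loops with and without a chip together, as `x k = 0` encodes the absence of a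
  -- chip.
  have hx : x k = loopCount x k * x k := by
    unfold loopCount
    split_ifs with h0 <;> simp [h0]
  rw [AddCommGroup.modEq_iff_eq_add_zsmul]
  -- The congruence expresses that `f` changes by the same amount along both edges. The initial
  -- slopes on the edges add up to `endSlope`, since no chip remains at the left vertex; the one on
  -- the top edge is the number of turns around the loop.
  refine ⟨Γ.graph.fwdSlope f (.top k) 0, ?_⟩
  rw [zsmul_eq_mul]
  push_cast
  rw [hb]
  linear_combination a1 - a2 - (Γ.bot k - x k) * hc - hx
    - (Γ.graph.fwdSlope f (.top k) 0 + Γ.graph.chipCount (.top k) (Γ.circ k - x k)) * hcirc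

/-- If at most one chip is left on a loop and the slope on the bridge before it is not too large,
then the function is increasing along both edges of the loop, by at most the length of the top
edge. -/
theorem IsMove.sub_mem_Icc (hf : IsMove D D' f) (hD : HasLoopChips D x) {k : Fin g}
    (h : Γ.endSlope f k.castSucc + loopCount x k ≤ Γ.startSlope f k.succ + 1)
    (h0 : 0 ≤ Γ.endSlope f k.castSucc)
    (h1 : (Γ.endSlope f k.castSucc + 1) * Γ.bot k ≤ Γ.top k) {s t : ℝ} (hs : 0 ≤ s) (hst : s ≤ t) :
    (t ≤ Γ.top k → f (Γ.graph.pt (.top k) t) - f (Γ.graph.pt (.top k) s) ∈ Set.Icc 0 (Γ.top k)) ∧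
    (t ≤ Γ.bot k → f (Γ.graph.pt (.bot k) t) - f (Γ.graph.pt (.bot k) s) ∈
      Set.Icc 0 (Γ.top k)) := by
  have b1 := hf.loop_balance hD k
  have b2 := (hf.edgeMove_top hD k).chipsAfter_nonneg
  have b3 := (hf.edgeMove_bot hD k).chipsAfter_nonneg
  have b4 := hf.effective (.vertex (.v k.castSucc))
  have b5 := hf.effective (.vertex (.w k.succ))
  obtain ⟨lo, hi, c1, c2, c3, c4⟩ :=
    (hf.edgeMove_top hD k).exists_slope_bounds (by linarith)
  obtain ⟨lo', hi', d1, d2, d3, d4⟩ :=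
    (hf.edgeMove_bot hD k).exists_slope_bounds (by linarith)
  have b6 := hf.v_eq hD k
  have b7 := hD.chipCount_add k
  have b8 : loopCount x k ≤ 1 := by unfold loopCount; split_ifs <;> norm_num
  have k1 : Γ.endSlope f k.castSucc - 1 ≤ lo + lo' := by linarith
  have k2 : hi + hi' ≤ Γ.endSlope f k.castSucc + 1 := by linarith
  have e1 : Γ.graph.len (.top k) = Γ.top k := rfl
  have e2 : Γ.graph.len (.bot k) = Γ.bot k := rfl
  rw [e1] at c4
  rw [e2] at d4
  clear b1 b2 b3 b4 b5 b6 b7 b8 c1 c2 d1 d2 h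
  set p := Γ.endSlope f k.castSucc
  set F : ℝ → ℝ := fun t => f (Γ.graph.pt (.top k) t) with hF
  set F' : ℝ → ℝ := fun t => f (Γ.graph.pt (.bot k) t) with hF'
  have E0 : F 0 = F' 0 := by
    simp only [hF, hF', pt_zero]; rfl
  have E1 : F (Γ.top k) = F' (Γ.bot k) := by
    simp only [hF, hF']
    rw [← e1, ← e2, pt_len, pt_len]; rfl
  change (t ≤ Γ.top k → F t - F s ∈ _) ∧ (t ≤ Γ.bot k → F' t - F' s ∈ _)
  have l0 := Γ.top_pos k
  have m0 := Γ.bot_pos k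
  have C : ∀ s t, 0 ≤ s → s ≤ t → t ≤ Γ.top k → lo * (t - s) ≤ F t - F s ∧
    F t - F s ≤ hi * (t - s) := c4
  have C' : ∀ s t, 0 ≤ s → s ≤ t → t ≤ Γ.bot k → lo' * (t - s) ≤ F' t - F' s ∧
    F' t - F' s ≤ hi' * (t - s) := d4
  clear c4 d4
  clear_value F F'
  have anti : ∀ {n : ℤ} {a : ℝ}, n ≤ 0 → 0 ≤ a → (n : ℝ) * a ≤ 0 := fun hn ha =>
    mul_nonpos_of_nonpos_of_nonneg (by exact_mod_cast hn) ha
  have mono : ∀ {n : ℤ} {a : ℝ}, 0 ≤ n → 0 ≤ a → 0 ≤ (n : ℝ) * a := fun hn ha =>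
    mul_nonneg (by exact_mod_cast hn) ha
  -- a function that decreases along an edge but does not decrease in total is constant
  have const : ∀ {H : ℝ → ℝ} {l : ℝ}, (∀ s t, 0 ≤ s → s ≤ t → t ≤ l → H t - H s ≤ 0) →
      0 ≤ H l - H 0 → 0 ≤ s → s ≤ t → t ≤ l → H t - H s = 0 := by
    intro H l hH h0l hs hst ht
    linarith [hH 0 s le_rfl hs (hst.trans ht), hH s t hs hst ht, hH t l (hs.trans hst) ht le_rfl]
  -- If `lo` is negative, then `hi ≤ 0` and `lo' ≥ 0`: `f` does not increase along the top edge and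
  -- does not decrease along the bottom edge. Both have the same end values, so both are constant.
  rcases lt_or_ge lo 0 with hlo | hlo
  · have g1 : 0 ≤ F (Γ.top k) - F 0 := by
      rw [E0, E1]
      exact (mono (by linarith) (by linarith)).trans (C' 0 _ le_rfl m0.le le_rfl).1
    have g2 : ∀ s t, 0 ≤ s → s ≤ t → t ≤ Γ.top k → F t - F s ≤ 0 := fun s t hs hst ht =>
      (C s t hs hst ht).2.trans (anti (by linarith) (by linarith))
    have g3 : ∀ s t, 0 ≤ s → s ≤ t → t ≤ Γ.bot k → 0 ≤ F' t - F' s := fun s t hs hst ht =>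
      (mono (by linarith) (by linarith)).trans (C' s t hs hst ht).1
    have g4 := g2 0 _ le_rfl l0.le le_rfl
    refine ⟨fun ht => ?_, fun ht => ⟨g3 s t hs hst ht, ?_⟩⟩
    · rw [const g2 g1 hs hst ht]
      exact ⟨le_rfl, l0.le⟩
    · linarith [g3 0 s le_rfl hs (hst.trans ht), g3 t _ (hs.trans hst) ht le_rfl]
  · have hp0 : (0 : ℝ) ≤ p := by exact_mod_cast h0
    -- With slopes at least `1` on the whole top edge, the growth along it would be at least its
    -- length, which is more than slope `p - 1` achieves on the much shorter bottom edge.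
    have hhi : hi ≤ 1 := by
      by_contra hhi
      have g1 : 1 * Γ.top k ≤ F (Γ.top k) - F 0 := by
        refine le_trans ?_ (C 0 _ le_rfl l0.le le_rfl).1
        rw [sub_zero]
        have : (1 : ℝ) ≤ lo := by exact_mod_cast (by linarith : 1 ≤ lo)
        exact mul_le_mul_of_nonneg_right this l0.le
      have g2 := (C' 0 _ le_rfl m0.le le_rfl).2
      rw [← E0, ← E1, sub_zero] at g2
      have : (hi' : ℝ) ≤ p - 1 := by
        have : hi' ≤ p - 1 := by linarith [not_le.1 hhi]
        exact_mod_cast this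
      nlinarith
    have hhi' : (hi : ℝ) ≤ 1 := by exact_mod_cast hhi
    have g1 : 0 ≤ F' (Γ.bot k) - F' 0 := by
      rw [← E0, ← E1]
      exact (mono hlo (by linarith)).trans (C 0 _ le_rfl l0.le le_rfl).1
    refine ⟨fun ht => ⟨(mono hlo (by linarith)).trans (C s t hs hst ht).1,
      (C s t hs hst ht).2.trans ?_⟩, fun ht => ?_⟩
    · nlinarith
    rcases lt_or_ge lo' 0 with hlo' | hlo'
    · have g2 : ∀ s t, 0 ≤ s → s ≤ t → t ≤ Γ.bot k → F' t - F' s ≤ 0 := fun s t hs hst ht =>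
        (C' s t hs hst ht).2.trans (anti (by linarith) (by linarith))
      rw [const g2 g1 hs hst ht]
      exact ⟨le_rfl, l0.le⟩
    · refine ⟨(mono hlo' (by linarith)).trans (C' s t hs hst ht).1,
        (C' s t hs hst ht).2.trans ?_⟩
      have hhi0 : 0 ≤ hi := by
        have := (mono hlo l0.le).trans
          ((by simpa using (C 0 _ le_rfl l0.le le_rfl).1 :
            (lo : ℝ) * Γ.top k ≤ F (Γ.top k) - F 0).trans
            (by simpa using (C 0 _ le_rfl l0.le le_rfl).2))
        have h2 : (0 : ℝ) ≤ hi := nonneg_of_mul_nonneg_left this l0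
        exact_mod_cast h2
      have : (hi' : ℝ) ≤ p + 1 := by
        have : hi' ≤ p + 1 := by linarith
        exact_mod_cast this
      nlinarith

end Move

end ChainOfLoops

/-! ### The lattice path and the sum of its coordinates. -/

namespace ChainOfLoops

variable {g r d : ℕ} {Γ : ChainOfLoops g} {D : Γ.graph.Divisor}

section Path

theorem latticePath_zero (j : Fin r) : Γ.latticePath D r 0 j = D Γ.leftEnd - (j : ℕ) := rfl

theorem latticePath_succ (k : Fin g) :
    Γ.latticePath D r k.succ = Γ.step D k (Γ.latticePath D r k.castSucc) := rfl

theorem step_of_chipPos_eq_zero {k : Fin g} (h : Γ.chipPos D k = 0) (p : Fin r → ℤ) :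
    Γ.step D k p = p - 1 := if_pos h

theorem step_of_not_exists {k : Fin g} (h : Γ.chipPos D k ≠ 0) {p : Fin r → ℤ}
    (h' : ¬ ∃ j, Γ.IsStepDirection D k p j) : Γ.step D k p = p := by
  rw [step, if_neg h, dif_neg h']

theorem exists_step_eq {k : Fin g} (h : Γ.chipPos D k ≠ 0) {p : Fin r → ℤ}
    (h' : ∃ j, Γ.IsStepDirection D k p j) :
    ∃ j, Γ.IsStepDirection D k p j ∧ Γ.step D k p = p + Pi.single j 1 := by
  rw [step, if_neg h, dif_pos h']
  exact ⟨_, h'.choose_spec, rfl⟩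

theorem step_le (k : Fin g) (p : Fin r → ℤ) (j : Fin r) :
    Γ.step D k p j ≤ p j + loopCount (Γ.chipPos D) k := by
  unfold loopCount
  split_ifs with h
  · rw [step_of_chipPos_eq_zero h]; simp
  · by_cases h' : ∃ j, Γ.IsStepDirection D k p j
    · obtain ⟨i, -, e⟩ := exists_step_eq h h'
      rw [e, Pi.add_apply, Pi.single_apply]
      split_ifs <;> simp
    · rw [step_of_not_exists h h']; simp

theorem le_step {k : Fin g} (h : Γ.chipPos D k ≠ 0) (p : Fin r → ℤ) (j : Fin r) :
    p j ≤ Γ.step D k p j := by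
  by_cases h' : ∃ j, Γ.IsStepDirection D k p j
  · obtain ⟨i, -, e⟩ := exists_step_eq h h'
    rw [e, Pi.add_apply, Pi.single_apply]
    split_ifs <;> simp
  · rw [step_of_not_exists h h']

theorem loopCount_nonneg (x : Fin g → ℝ) (k : Fin g) : 0 ≤ loopCount x k := by
  unfold loopCount; split_ifs <;> norm_num

theorem latticePath_le_add_sum (k : Fin (g + 1)) (j : Fin r) :
    Γ.latticePath D r k j ≤
      D Γ.leftEnd + ∑ l with Fin.castSucc l < k, loopCount (Γ.chipPos D) l := by
  induction k using Fin.induction with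
  | zero => simp [latticePath_zero]
  | succ k ih =>
    have e : (Finset.univ.filter fun l : Fin g => l.castSucc < k.succ) =
        insert k (Finset.univ.filter fun l : Fin g => l.castSucc < k.castSucc) := by
      ext l
      simp [le_iff_eq_or_lt]
    rw [e, Finset.sum_insert (by simp), latticePath_succ]
    have := step_le (D := D) k (Γ.latticePath D r k.castSucc) j
    linarith

/-- This bound is what allows congruences between multiples of `Γ.bot k` to be turned into
equalities, through `SlopeBounds.small`. -/
theorem latticePath_le (k : Fin (g + 1)) (j : Fin r) :
    Γ.latticePath D r k j ≤ D Γ.leftEnd + ∑ l, loopCount (Γ.chipPos D) l := by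
  refine (latticePath_le_add_sum k j).trans (add_le_add_right ?_ _)
  exact Finset.sum_le_sum_of_subset_of_nonneg (Finset.filter_subset _ _)
    fun l _ _ => loopCount_nonneg _ l

-- The three kinds of steps change the sum by `-r`, `1` and `0`; the formula covers all of them, so
-- that summing it brings in the number of lingering steps.
open Classical in
theorem sum_step (k : Fin g) :
    ∑ j, Γ.latticePath D r k.succ j - ∑ j, Γ.latticePath D r k.castSucc j =
      (r + 1) * loopCount (Γ.chipPos D) k - r - if Γ.IsLingering D r k then 1 else 0 := by
  rw [latticePath_succ]
  unfold loopCount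
  by_cases h : Γ.chipPos D k = 0
  · have hl : ¬ Γ.IsLingering D r k := fun h' => h'.1 h
    rw [if_pos h, if_neg hl, step_of_chipPos_eq_zero h]
    simp
  · by_cases h' : ∃ j, Γ.IsStepDirection D k (Γ.latticePath D r k.castSucc) j
    · have hl : ¬ Γ.IsLingering D r k := fun h'' => h''.2 h'
      obtain ⟨i, -, e⟩ := exists_step_eq h h'
      rw [if_neg h, if_neg hl, e]
      simp [Finset.sum_add_distrib]
    · have hl : Γ.IsLingering D r k := ⟨h, h'⟩
      rw [if_neg h, if_pos hl, step_of_not_exists h h']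
      ring

theorem sum_succ_sub_castSucc (f : Fin (g + 1) → ℤ) :
    ∑ k : Fin g, (f k.succ - f k.castSucc) = f (Fin.last g) - f 0 := by
  have h1 := Fin.sum_univ_succ f
  have h2 := Fin.sum_univ_castSucc f
  rw [Finset.sum_sub_distrib]
  linarith

theorem sum_latticePath_last :
    ∑ j, Γ.latticePath D r (Fin.last g) j - ∑ j, Γ.latticePath D r 0 j =
      (r + 1) * ∑ k, loopCount (Γ.chipPos D) k - r * g -
        (Set.ncard {k | Γ.IsLingering D r k} : ℤ) := by
  classical
  rw [← sum_succ_sub_castSucc fun k => ∑ j, Γ.latticePath D r k j,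
    Finset.sum_congr rfl fun k _ => sum_step k, Finset.sum_sub_distrib, Finset.sum_sub_distrib,
    ← Finset.mul_sum, Finset.sum_boole, Set.ncard_eq_toFinset_card']
  simp [mul_comm]

end Path

/-! ### The slopes on the bridges are the coordinates of the lattice path. -/

/-- The lattice path with an additional last coordinate zero. -/
noncomputable def extendedPath (Γ : ChainOfLoops g) (D : Γ.graph.Divisor) (r : ℕ)
    (k : Fin (g + 1)) : Fin (r + 1) → ℤ := Fin.snoc (α := fun _ => ℤ) (Γ.latticePath D r k) 0

@[simp] theorem extendedPath_castSucc (k : Fin (g + 1)) (j : Fin r) :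
    Γ.extendedPath D r k j.castSucc = Γ.latticePath D r k j := Fin.snoc_castSucc ..

@[simp] theorem extendedPath_last (k : Fin (g + 1)) :
    Γ.extendedPath D r k (Fin.last r) = 0 := Fin.snoc_last ..

/-- Bounds for the slopes `A i` at the left ends and `B i` at the right ends of the bridges, for
functions that move `D` to divisors with `i` chips at the left end and `r - i` chips at the right
end. -/
structure SlopeBounds (Γ : ChainOfLoops g) (D : Γ.graph.Divisor) (r : ℕ)
    (A B : Fin (r + 1) → Fin (g + 1) → ℤ) : Prop where
  le_start : ∀ i k, B i k ≤ A i k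
  zero_le : ∀ i : Fin (r + 1), A i 0 ≤ D Γ.leftEnd - (i : ℕ)
  le_last : ∀ i : Fin (r + 1), (r : ℤ) - (i : ℕ) ≤ B i (Fin.last g)
  succ_le : ∀ i k, A i k.succ ≤ B i k.castSucc + loopCount (Γ.chipPos D) k
  modEq : ∀ i k, A i k.succ = B i k.castSucc + loopCount (Γ.chipPos D) k →
    Γ.chipPos D k ≡
      (B i k.castSucc + loopCount (Γ.chipPos D) k : ℤ) * Γ.bot k [PMOD Γ.circ k]
  chipPos_nonneg : ∀ k, 0 ≤ Γ.chipPos D k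
  chipPos_lt : ∀ k, Γ.chipPos D k < Γ.circ k
  small : ∀ k, (D Γ.leftEnd + ∑ l, loopCount (Γ.chipPos D) l : ℤ) * Γ.bot k < Γ.circ k

theorem loopCount_of_eq {x : Fin g → ℝ} {k : Fin g} (h : x k = 0) : loopCount x k = 0 := if_pos h

theorem loopCount_of_ne {x : Fin g → ℝ} {k : Fin g} (h : x k ≠ 0) : loopCount x k = 1 := if_neg h

theorem not_chipPos_modEq_zero {k : Fin g} (h0 : 0 ≤ Γ.chipPos D k)
    (h1 : Γ.chipPos D k < Γ.circ k) (h : Γ.chipPos D k ≠ 0) :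
    ¬ Γ.chipPos D k ≡ 0 [PMOD Γ.circ k] := by
  intro hm
  rw [AddCommGroup.modEq_zero_iff_eq_zsmul] at hm
  obtain ⟨z, hz⟩ := hm
  rw [zsmul_eq_mul] at hz
  have hc : 0 < Γ.circ k := h0.trans_lt h1
  have hz1 : z < 1 := by
    have : (z : ℝ) * Γ.circ k < 1 * Γ.circ k := by linarith
    exact_mod_cast lt_of_mul_lt_mul_right this hc.le
  have hz0 : -1 < z := by
    have : (-1 : ℝ) * Γ.circ k < z * Γ.circ k := by linarith
    exact_mod_cast lt_of_mul_lt_mul_right this hc.le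
  obtain rfl : z = 0 := by omega
  simp at hz
  exact h hz

/-- The two multiples differ by less than one circumference. -/
theorem eq_of_mul_bot_modEq {k : Fin g} {a b N : ℤ} (hN : N * Γ.bot k < Γ.circ k)
    (h1 : a - b ≤ N) (h2 : b - a ≤ N) (h : a * Γ.bot k ≡ b * Γ.bot k [PMOD Γ.circ k]) :
    a = b := by
  rw [AddCommGroup.modEq_iff_eq_add_zsmul] at h
  obtain ⟨z, hz⟩ := h
  rw [zsmul_eq_mul] at hz
  have hb := Γ.bot_pos k
  have hc : 0 < Γ.circ k := add_pos (Γ.top_pos k) hb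
  have h1' : (a - b : ℝ) ≤ N := by exact_mod_cast h1
  have h2' : (b - a : ℝ) ≤ N := by exact_mod_cast h2
  have h3 : (z : ℝ) * Γ.circ k = (b - a) * Γ.bot k := by linarith
  have hz1 : z < 1 := by
    have : (z : ℝ) * Γ.circ k < 1 * Γ.circ k := by
      rw [h3]; nlinarith
    exact_mod_cast lt_of_mul_lt_mul_right this hc.le
  have hz0 : -1 < z := by
    have : (-1 : ℝ) * Γ.circ k < z * Γ.circ k := by
      rw [h3]; nlinarith
    exact_mod_cast lt_of_mul_lt_mul_right this hc.le
  obtain rfl : z = 0 := by omega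
  simp at hz
  rcases hz with hz | hz
  · exact hz.symm
  · exact absurd hz hb.ne'

namespace SlopeBounds

variable {A B : Fin (r + 1) → Fin (g + 1) → ℤ}

/-- Going from right to left, a first negative slope would be `-1` and become `0` across a loop with
a chip. This is the case of equality, which puts the chip at the left vertex of the loop. -/
theorem nonneg (h : SlopeBounds Γ D r A B) (i : Fin (r + 1)) (k : Fin (g + 1)) : 0 ≤ B i k := by
  induction k using Fin.reverseInduction with
  | last =>
    have := h.le_last i
    omega
  | cast k ih =>
    have h1 := h.le_start i k.succ
    have h2 := h.succ_le i k
    by_cases hx : Γ.chipPos D k = 0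
    · rw [loopCount_of_eq hx] at h2; linarith
    rw [loopCount_of_ne hx] at h2
    by_contra hneg
    have h3 : B i k.castSucc = -1 := by omega
    have h4 : A i k.succ = 0 := by omega
    have h5 := h.modEq i k (by rw [loopCount_of_ne hx, h3, h4]; rfl)
    rw [loopCount_of_ne hx, h3] at h5
    simp only [neg_add_cancel, Int.cast_zero, zero_mul] at h5
    exact not_chipPos_modEq_zero (h.chipPos_nonneg k) (h.chipPos_lt k) hx h5

/-- As for `nonneg`: a change of slope from `0` to `1` would put the chip at the right vertex of the
loop, against `ne_bot`. -/
theorem one_le (h : SlopeBounds Γ D r A B) (hD : Γ.IsVertexAvoiding D r d) (j : Fin r)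
    (k : Fin (g + 1)) : 1 ≤ B j.castSucc k := by
  induction k using Fin.reverseInduction with
  | last =>
    have := h.le_last j.castSucc
    have := j.isLt
    rw [Fin.val_castSucc] at *
    omega
  | cast k ih =>
    have h1 := h.le_start j.castSucc k.succ
    have h2 := h.succ_le j.castSucc k
    by_cases hx : Γ.chipPos D k = 0
    · rw [loopCount_of_eq hx] at h2; linarith
    rw [loopCount_of_ne hx] at h2
    by_contra hneg
    have h3 : B j.castSucc k.castSucc = 0 := by omega
    have h4 : A j.castSucc k.succ = 1 := by omega
    have h5 := h.modEq j.castSucc k (by rw [loopCount_of_ne hx, h3, h4]; rfl)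
    rw [loopCount_of_ne hx, h3] at h5
    simp only [zero_add, Int.cast_one, one_mul] at h5
    exact hD.ne_bot k h5

/-- On a loop without a chip, only slope zero is preserved. -/
theorem eq_zero_of_succ_eq (h : SlopeBounds Γ D r A B) {i : Fin (r + 1)} {k : Fin g}
    (hx : Γ.chipPos D k = 0) (hA : A i k.succ = B i k.castSucc)
    (hB : B i k.castSucc ≤ D Γ.leftEnd + ∑ l, loopCount (Γ.chipPos D) l) :
    B i k.castSucc = 0 := by
  have h5 := h.modEq i k (by rw [loopCount_of_eq hx, hA, add_zero])
  rw [hx, loopCount_of_eq (x := Γ.chipPos D) hx, add_zero] at h5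
  have h0 := h.nonneg i k.castSucc
  refine (eq_of_mul_bot_modEq (h.small k) (a := B i k.castSucc) (b := 0) ?_ ?_ ?_) <;>
    try linarith
  simpa using h5.symm

/-- Induction from the left. A slope that would overtake the path at a loop must rise there from
exactly the path coordinate; the resulting congruence makes the path take the same step. That the
path stays in the chamber has to be carried along, since steps `e_j` are allowed only there. -/
theorem path_bound (h : SlopeBounds Γ D r A B) (hD : Γ.IsVertexAvoiding D r d)
    (k : Fin (g + 1)) :
    Γ.latticePath D r k ∈ weylChamber r ∧
      ∀ j : Fin r, A j.castSucc k ≤ Γ.latticePath D r k j := by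
  induction k using Fin.induction with
  | zero =>
    have h1 : ∀ j : Fin r, A j.castSucc 0 ≤ Γ.latticePath D r 0 j := fun j => h.zero_le j.castSucc
    refine ⟨⟨fun a b hab => ?_, fun j => ?_⟩, h1⟩
    · simp only [latticePath_zero]
      have : (a : ℕ) < b := hab
      omega
    · have := h1 j
      have := h.le_start j.castSucc 0
      have := h.one_le hD j 0
      omega
  | succ k ih =>
    obtain ⟨⟨hanti, hpos⟩, hle⟩ := ih
    have hB : ∀ j : Fin r, B j.castSucc k.castSucc ≤ Γ.latticePath D r k.castSucc j := fun j =>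
      (h.le_start _ _).trans (hle j)
    rw [latticePath_succ]
    by_cases hx : Γ.chipPos D k = 0
    · have key : ∀ j : Fin r, A j.castSucc k.succ ≤ Γ.step D k (Γ.latticePath D r k.castSucc) j := by
        intro j
        rw [step_of_chipPos_eq_zero hx]
        have h2 := h.succ_le j.castSucc k
        rw [loopCount_of_eq hx, add_zero] at h2
        rcases h2.eq_or_lt with h2 | h2
        · have h3 := h.eq_zero_of_succ_eq hx h2 ((hB j).trans (latticePath_le _ j))
          have h4 := h.one_le hD j k.castSucc
          omega
        · have := hB j
          simp only [Pi.sub_apply, Pi.one_apply]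
          omega
      refine ⟨⟨fun a b hab => ?_, fun j => ?_⟩, key⟩
      · rw [step_of_chipPos_eq_zero hx]
        have := hanti hab
        simp only [Pi.sub_apply, Pi.one_apply]
        omega
      · have := key j
        have := h.le_start j.castSucc k.succ
        have := h.one_le hD j k.succ
        omega
    · refine ⟨?_, fun j => ?_⟩
      · by_cases h' : ∃ j, Γ.IsStepDirection D k (Γ.latticePath D r k.castSucc) j
        · obtain ⟨i, hi, e⟩ := exists_step_eq hx h'
          rw [e]
          exact hi.2.2
        · rw [step_of_not_exists hx h']
          exact ⟨hanti, hpos⟩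
      · have h2 := h.succ_le j.castSucc k
        rw [loopCount_of_ne hx] at h2
        have h3 := hB j
        have h4 := le_step hx (Γ.latticePath D r k.castSucc) j
        by_contra hlt
        have h5 : B j.castSucc k.castSucc = Γ.latticePath D r k.castSucc j := by omega
        have h6 := h.modEq j.castSucc k (by rw [loopCount_of_ne hx]; omega)
        rw [loopCount_of_ne hx, h5] at h6
        have hdir : Γ.IsStepDirection D k (Γ.latticePath D r k.castSucc) j := by
          refine ⟨by exact_mod_cast h6, ⟨hanti, hpos⟩, fun a b hab => ?_, fun i => ?_⟩
          · have h7 := hanti hab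
            simp only [Pi.add_apply, Pi.single_apply]
            by_cases hb : b = j
            · subst hb
              rw [if_pos rfl, if_neg hab.ne]
              -- The step can leave the chamber only by running into a coordinate that is larger by
              -- one, and then the chip would be in a position forbidden by `ne_path`.
              have h8 : Γ.latticePath D r k.castSucc a ≠ Γ.latticePath D r k.castSucc b + 1 := by
                intro h9
                refine hD.ne_path k a ?_
                rw [h9]
                exact h6
              omega
            · rw [if_neg hb]
              split_ifs <;> omega
          · have := hpos i
            simp only [Pi.add_apply, Pi.single_apply]
            split_ifs <;> omega
        obtain ⟨i, hi, e⟩ := exists_step_eq hx ⟨j, hdir⟩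
        -- The direction chosen in `step` is a priori another one, `i`. Both satisfy the same
        -- congruence, so they coincide.
        have hij : Γ.latticePath D r k.castSucc i + 1 = Γ.latticePath D r k.castSucc j + 1 := by
          have b1 := latticePath_le (D := D) k.castSucc i
          have b2 := latticePath_le (D := D) k.castSucc j
          have b3 := hpos i
          have b4 := hpos j
          refine eq_of_mul_bot_modEq (h.small k) (by linarith) (by linarith) ?_
          push_cast
          exact hi.1.symm.trans hdir.1
        obtain rfl : i = j := hanti.injective (by linarith)
        rw [e] at hlt
        simp only [Pi.add_apply, Pi.single_eq_same] at hlt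
        omega

/-- The slopes at the right end force the last point of the path to be at least `(r, …, 1)`. With
exactly `ρ` lingering steps and degree at most `d`, the total excess over this point is at most `r -
d_0`, which is at most zero because `φ r` needs `d_0 ≥ r`. So there is no excess and `d_0 = r`. -/
theorem last_eq (h : SlopeBounds Γ D r A B) (hD : Γ.IsVertexAvoiding D r d)
    (hd : D Γ.leftEnd + ∑ l, loopCount (Γ.chipPos D) l ≤ d) :
    D Γ.leftEnd = r ∧ ∀ j : Fin r, Γ.latticePath D r (Fin.last g) j = r - (j : ℕ) := by
  have h0 : (r : ℤ) ≤ D Γ.leftEnd := by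
    have h1 := h.zero_le (Fin.last r)
    have h2 := h.le_start (Fin.last r) 0
    have h3 := h.nonneg (Fin.last r) 0
    rw [Fin.val_last] at h1
    omega
  have hge : ∀ j : Fin r, (r : ℤ) - (j : ℕ) ≤ Γ.latticePath D r (Fin.last g) j := fun j =>
    (h.le_last j.castSucc).trans ((h.le_start _ _).trans ((h.path_bound hD _).2 j))
  have hsum : ∑ j : Fin r, (Γ.latticePath D r (Fin.last g) j - (r - (j : ℕ))) ≤
      r - D Γ.leftEnd := by
    have h1 := sum_latticePath_last (Γ := Γ) (D := D) (r := r)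
    rw [hD.lingering] at h1
    have h2 : ∑ j : Fin r, (Γ.latticePath D r 0 j - (r - (j : ℕ))) = r * (D Γ.leftEnd - r) := by
      rw [Finset.sum_congr rfl fun j _ => show _ = D Γ.leftEnd - (r : ℤ) by
        rw [latticePath_zero]; ring]
      simp [mul_sub]
    rw [Finset.sum_sub_distrib] at h2 ⊢
    unfold brillNoetherNumber at h1
    have h3 : ((r : ℤ) + 1) * ∑ l, loopCount (Γ.chipPos D) l ≤ (r + 1) * (d - D Γ.leftEnd) :=
      mul_le_mul_of_nonneg_left (by linarith) (by positivity)
    linarith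
  have hnn : ∀ j ∈ (Finset.univ : Finset (Fin r)),
      0 ≤ Γ.latticePath D r (Fin.last g) j - (r - (j : ℕ)) := fun j _ => sub_nonneg.2 (hge j)
  have hsum0 := Finset.sum_nonneg hnn
  refine ⟨by linarith, fun j => ?_⟩
  have h1 := Finset.single_le_sum hnn (Finset.mem_univ j)
  have := hge j
  linarith

/-- The slope starts at most at `d_0 - r = 0`, and a rise from `0` to `1` is excluded by `ne_bot`.
-/
theorem last_le_zero (h : SlopeBounds Γ D r A B) (hD : Γ.IsVertexAvoiding D r d)
    (hd : D Γ.leftEnd + ∑ l, loopCount (Γ.chipPos D) l ≤ d) (k : Fin (g + 1)) :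
    A (Fin.last r) k ≤ 0 := by
  induction k using Fin.induction with
  | zero =>
    have h1 := h.zero_le (Fin.last r)
    rw [(h.last_eq hD hd).1] at h1
    simpa using h1
  | succ k ih =>
    have h1 := h.le_start (Fin.last r) k.castSucc
    have h2 := h.succ_le (Fin.last r) k
    by_cases hx : Γ.chipPos D k = 0
    · rw [loopCount_of_eq hx] at h2; linarith
    rw [loopCount_of_ne hx] at h2
    by_contra hpos
    have h3 : B (Fin.last r) k.castSucc = 0 := by omega
    have h5 := h.modEq (Fin.last r) k (by rw [loopCount_of_ne hx, h3]; omega)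
    rw [loopCount_of_ne hx, h3] at h5
    simp only [zero_add, Int.cast_one, one_mul] at h5
    exact hD.ne_bot k h5

theorem start_le (h : SlopeBounds Γ D r A B) (hD : Γ.IsVertexAvoiding D r d)
    (hd : D Γ.leftEnd + ∑ l, loopCount (Γ.chipPos D) l ≤ d) (i : Fin (r + 1))
    (k : Fin (g + 1)) : A i k ≤ Γ.extendedPath D r k i := by
  cases i using Fin.lastCases with
  | last => simpa using h.last_le_zero hD hd k
  | cast j => simpa using (h.path_bound hD k).2 j

/-- Induction from the right, starting from `last_eq`. A slope that is below the path before a loop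
with a chip and not below it afterwards must rise to exactly the path coordinate before that loop,
and `ne_path` excludes the corresponding position of the chip. -/
theorem le_end (h : SlopeBounds Γ D r A B) (hD : Γ.IsVertexAvoiding D r d)
    (hd : D Γ.leftEnd + ∑ l, loopCount (Γ.chipPos D) l ≤ d) (i : Fin (r + 1))
    (k : Fin (g + 1)) : Γ.extendedPath D r k i ≤ B i k := by
  cases i using Fin.lastCases with
  | last => simpa using h.nonneg _ k
  | cast j =>
    rw [extendedPath_castSucc]
    induction k using Fin.reverseInduction with
    | last =>
      rw [(h.last_eq hD hd).2]
      exact h.le_last j.castSucc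
    | cast k ih =>
      have h1 := h.le_start j.castSucc k.succ
      have h2 := h.succ_le j.castSucc k
      have h4 := (h.path_bound hD k.castSucc).2 j
      have h5 := h.le_start j.castSucc k.castSucc
      by_cases hx : Γ.chipPos D k = 0
      · rw [loopCount_of_eq hx, add_zero] at h2
        rw [latticePath_succ, step_of_chipPos_eq_zero hx] at ih
        simp only [Pi.sub_apply, Pi.one_apply] at ih
        rcases h2.eq_or_lt with h2 | h2
        · have h3 := h.eq_zero_of_succ_eq hx h2 (h5.trans (h4.trans (latticePath_le _ j)))
          have := h.one_le hD j k.castSucc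
          omega
        · omega
      · rw [loopCount_of_ne hx] at h2
        have h3 := le_step hx (Γ.latticePath D r k.castSucc) j
        rw [latticePath_succ] at ih
        by_contra hlt
        have h6 : B j.castSucc k.castSucc + 1 = Γ.latticePath D r k.castSucc j := by omega
        have h7 := h.modEq j.castSucc k (by rw [loopCount_of_ne hx]; omega)
        rw [loopCount_of_ne hx, h6] at h7
        exact hD.ne_path k j h7

theorem start_eq (h : SlopeBounds Γ D r A B) (hD : Γ.IsVertexAvoiding D r d)
    (hd : D Γ.leftEnd + ∑ l, loopCount (Γ.chipPos D) l ≤ d) (i : Fin (r + 1))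
    (k : Fin (g + 1)) : A i k = Γ.extendedPath D r k i :=
  le_antisymm (h.start_le hD hd i k) ((h.le_end hD hd i k).trans (h.le_start i k))

theorem end_eq (h : SlopeBounds Γ D r A B) (hD : Γ.IsVertexAvoiding D r d)
    (hd : D Γ.leftEnd + ∑ l, loopCount (Γ.chipPos D) l ≤ d) (i : Fin (r + 1))
    (k : Fin (g + 1)) : B i k = Γ.extendedPath D r k i :=
  le_antisymm ((h.le_start i k).trans (h.start_le hD hd i k)) (h.le_end hD hd i k)

end SlopeBounds

theorem extendedPath_injective {k : Fin (g + 1)} (h : Γ.latticePath D r k ∈ weylChamber r) :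
    Function.Injective (Γ.extendedPath D r k) := by
  intro a b hab
  cases a using Fin.lastCases with
  | last =>
    cases b using Fin.lastCases with
    | last => rfl
    | cast b =>
      have := h.2 b
      rw [extendedPath_last, extendedPath_castSucc] at hab
      omega
  | cast a =>
    cases b using Fin.lastCases with
    | last =>
      have := h.2 a
      rw [extendedPath_last, extendedPath_castSucc] at hab
      omega
    | cast b =>
      rw [extendedPath_castSucc, extendedPath_castSucc] at hab
      rw [h.1.injective hab]

/-- At every loop all coordinates of the extended path change by the same amount, with at most one
exception, which is larger by one. -/
theorem extendedPath_succ (k : Fin g) :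
    ((∀ i, Γ.extendedPath D r k.succ i =
      Γ.extendedPath D r k.castSucc i + loopCount (Γ.chipPos D) k - 1)) ∨
    ∃ j, ∀ i, Γ.extendedPath D r k.succ i =
      Γ.extendedPath D r k.castSucc i + loopCount (Γ.chipPos D) k - 1 + if i = j then 1 else 0 := by
  by_cases hx : Γ.chipPos D k = 0
  · right
    -- A step `(-1, …, -1)` singles out the additional coordinate, which stays at zero.
    refine ⟨Fin.last r, fun i => ?_⟩
    rw [loopCount_of_eq hx]
    cases i using Fin.lastCases with
    | last => simp
    | cast j =>
      simp [latticePath_succ, step_of_chipPos_eq_zero hx, Fin.castSucc_ne_last]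
  · rw [loopCount_of_ne hx]
    by_cases h' : ∃ j, Γ.IsStepDirection D k (Γ.latticePath D r k.castSucc) j
    · right
      obtain ⟨j, -, e⟩ := exists_step_eq hx h'
      refine ⟨j.castSucc, fun i => ?_⟩
      cases i using Fin.lastCases with
      | last => simp [(Fin.castSucc_ne_last j).symm]
      | cast i => simp [latticePath_succ, e, Pi.single_apply]
    · left
      intro i
      cases i using Fin.lastCases with
      | last => simp
      | cast i => simp [latticePath_succ, step_of_not_exists hx h']

end ChainOfLoops

/-! ### Multisets with small sums. -/

theorem Multiset.eq_replicate_add_of_sum_le_one {s : Multiset ℕ} (h : s.sum ≤ 1) :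
    s = Multiset.replicate (s.card - s.sum) 0 + Multiset.replicate s.sum 1 := by
  induction s using Multiset.induction with
  | empty => simp
  | cons a s ih =>
    rw [Multiset.sum_cons] at h
    have ih := ih (by omega)
    have hcard : s.sum ≤ s.card := by
      have := congrArg Multiset.card ih
      simp at this
      omega
    rw [Multiset.sum_cons, Multiset.card_cons]
    obtain rfl | ⟨rfl, h0⟩ : a = 0 ∨ a = 1 ∧ s.sum = 0 := by omega
    · rw [zero_add, show s.card + 1 - s.sum = s.card - s.sum + 1 by omega, Multiset.replicate_succ,
        Multiset.cons_add, ← ih]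
    · rw [h0] at ih ⊢
      simp only [Nat.sub_zero, Multiset.replicate_zero, add_zero] at ih
      simp [← ih, ← Multiset.singleton_add, add_comm]

section Sym

variable {ι : Type*} {m : ℕ} {I J : Sym ι m}

/-- A multiset of naturals with sum `0` or `1` is determined by its size and its sum. This produces
the two chips at either end of the chain. -/
theorem Sym.map_sum_ge_two_of_ne {f : ι → ℕ} (hf : Function.Injective f) (hIJ : I ≠ J)
    (h : ((I : Multiset ι).map f).sum = ((J : Multiset ι).map f).sum) :
    2 ≤ ((I : Multiset ι).map f).sum := by
  by_contra hlt
  have h1 := Multiset.eq_replicate_add_of_sum_le_one (s := (I : Multiset ι).map f) (by omega)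
  have h2 := Multiset.eq_replicate_add_of_sum_le_one (s := (J : Multiset ι).map f) (by omega)
  rw [← h, Multiset.card_map, Sym.card_coe] at h2
  rw [Multiset.card_map, Sym.card_coe] at h1
  exact hIJ (Sym.coe_injective (Multiset.map_injective hf (h1.trans h2.symm)))

theorem Sym.two_le_of_ne {f : ι → ℤ} (hf : Function.Injective f) (hIJ : I ≠ J)
    (h : ((I : Multiset ι).map f).sum = ((J : Multiset ι).map f).sum) : 2 ≤ m := by
  by_contra hlt
  apply hIJ
  apply Sym.coe_injective
  obtain hm | hm : m = 0 ∨ m = 1 := by omega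
  · have h1 := (Sym.card_coe (s := I)).trans hm
    have h2 := (Sym.card_coe (s := J)).trans hm
    rw [Multiset.card_eq_zero] at h1 h2
    rw [h1, h2]
  · have h1 := (Sym.card_coe (s := I)).trans hm
    have h2 := (Sym.card_coe (s := J)).trans hm
    rw [Multiset.card_eq_one] at h1 h2
    obtain ⟨a, ha⟩ := h1
    obtain ⟨b, hb⟩ := h2
    rw [ha, hb] at h ⊢
    simp only [Multiset.map_singleton, Multiset.sum_singleton] at h
    rw [hf h]

theorem Multiset.sum_map_mem_Icc {u : ι → ℝ} {a : ℝ} (hu : ∀ i, u i ∈ Set.Icc 0 a)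
    (s : Multiset ι) : (s.map u).sum ∈ Set.Icc 0 (s.card * a) := by
  induction s using Multiset.induction with
  | empty => simp
  | cons i s ih =>
    rw [Multiset.map_cons, Multiset.sum_cons, Multiset.card_cons]
    have := hu i
    push_cast
    constructor
    · linarith [this.1, ih.1]
    · linarith [this.2, ih.2]

end Sym

/-! ### Harmonic functions on the chain. -/

namespace ChainOfLoops

open MetricGraph

variable {g r d m : ℕ} {Γ : ChainOfLoops g}

section Harmonic

variable {f : Γ.graph.Point → ℝ}

theorem hasLoopChips_zero : HasLoopChips (0 : Γ.graph.Divisor) 0 := by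
  have hc : ∀ k, Γ.circ k = Γ.top k + Γ.bot k := fun k => rfl
  refine ⟨fun k => le_rfl, fun k => add_pos (Γ.top_pos k) (Γ.bot_pos k),
    fun k => (Γ.bot_pos k).ne, fun _ _ _ _ => rfl, fun _ => rfl, fun _ => rfl,
    fun k t h0 _ => ?_, fun k t _ h1 => ?_⟩
  · rw [if_neg (by simpa using h0.ne')]; rfl
  · rw [if_neg]
    · rfl
    · have := hc k
      have := Γ.bot_pos k
      simp only [Pi.zero_apply, sub_zero]
      linarith

/-- Without chips the slopes can only fall from left to right, and they are zero at both ends. -/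
theorem startSlope_eq_zero_of_isMove_zero (hf : IsMove (0 : Γ.graph.Divisor) 0 f)
    (j : Fin (g + 1)) : Γ.startSlope f j = 0 ∧ Γ.endSlope f j = 0 := by
  have hle : ∀ j, Γ.startSlope f j ≤ 0 := by
    intro j
    induction j using Fin.induction with
    | zero => simp [hf.startSlope_zero]
    | succ k ih =>
      have h1 := hf.startSlope_succ_le hasLoopChips_zero k
      have h2 := hf.endSlope_le_startSlope hasLoopChips_zero k.castSucc
      rw [loopCount, Pi.zero_apply, if_pos rfl] at h1
      linarith
  have hge : ∀ j, 0 ≤ Γ.endSlope f j := by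
    intro j
    induction j using Fin.reverseInduction with
    | last => simp [hf.endSlope_last hasLoopChips_zero]
    | cast k ih =>
      have h1 := hf.startSlope_succ_le hasLoopChips_zero k
      have h2 := hf.endSlope_le_startSlope hasLoopChips_zero k.succ
      rw [loopCount, Pi.zero_apply, if_pos rfl] at h1
      linarith
  have h := hf.endSlope_le_startSlope hasLoopChips_zero j
  have := hle j
  have := hge j
  constructor <;> linarith

/-- A harmonic function is constant. -/
theorem eq_of_div_eq_zero (hbt : ∀ k, Γ.bot k ≤ Γ.top k) (hf : Γ.graph.IsPL f)
    (hdiv : ∀ y, Γ.graph.div f y = 0) (y : Γ.graph.Point) : f y = f Γ.leftEnd := by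
  -- Both `f` and `-f` move the zero divisor to itself, so by `sub_mem_Icc` neither of them
  -- decreases along a loop.
  have h1 : IsMove (0 : Γ.graph.Divisor) 0 f := ⟨hf, fun _ => le_rfl, fun y => by simp [hdiv y]⟩
  have h2 : IsMove (0 : Γ.graph.Divisor) 0 (-f) :=
    ⟨hf.neg, fun _ => le_rfl, fun y => by simp [div_neg hf, hdiv y]⟩
  have loop : ∀ (k : Fin g) (t : ℝ), 0 ≤ t →
      (t ≤ Γ.top k → f (Γ.graph.pt (.top k) t) = f (.vertex (.v k.castSucc))) ∧
      (t ≤ Γ.bot k → f (Γ.graph.pt (.bot k) t) = f (.vertex (.v k.castSucc))) := by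
    intro k t ht
    have e1 : Γ.graph.pt (.top k) 0 = .vertex (.v k.castSucc) := pt_zero Γ.graph (.top k)
    have e2 : Γ.graph.pt (.bot k) 0 = .vertex (.v k.castSucc) := pt_zero Γ.graph (.bot k)
    have key : ∀ {f : Γ.graph.Point → ℝ}, IsMove (0 : Γ.graph.Divisor) 0 f →
        (t ≤ Γ.top k → f (Γ.graph.pt (.top k) t) - f (Γ.graph.pt (.top k) 0) ∈
          Set.Icc 0 (Γ.top k)) ∧
        (t ≤ Γ.bot k → f (Γ.graph.pt (.bot k) t) - f (Γ.graph.pt (.bot k) 0) ∈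
          Set.Icc 0 (Γ.top k)) := by
      intro f hf
      refine hf.sub_mem_Icc hasLoopChips_zero ?_ ?_ ?_ le_rfl ht
      · rw [(startSlope_eq_zero_of_isMove_zero hf _).1, (startSlope_eq_zero_of_isMove_zero hf _).2]
        simp [loopCount]
      · rw [(startSlope_eq_zero_of_isMove_zero hf _).2]
      · rw [(startSlope_eq_zero_of_isMove_zero hf _).2]
        simpa using hbt k
    have k1 := key h1
    have k2 := key h2
    simp only [e1, e2, Pi.neg_apply] at k1 k2
    exact ⟨fun h => by linarith [(k1.1 h).1, (k2.1 h).1],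
      fun h => by linarith [(k1.2 h).1, (k2.2 h).1]⟩
  have bridge : ∀ (j : Fin (g + 1)) (t : ℝ), 0 ≤ t → t ≤ Γ.bridge j →
      f (Γ.graph.pt (.bridge j) t) = f (.vertex (.w j)) := by
    intro j t h0 ht
    have e : Γ.graph.pt (.bridge j) 0 = .vertex (.w j) := pt_zero Γ.graph (.bridge j)
    obtain ⟨h3, h4⟩ := startSlope_eq_zero_of_isMove_zero h1 j
    have := h1.sub_eq_of_slopes_eq hasLoopChips_zero (h4.trans h3.symm) le_rfl h0 ht
    rw [h3, e] at this
    push_cast at this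
    linarith
  have hv : ∀ j, f (.vertex (.v j)) = f (.vertex (.w j)) := by
    intro j
    rw [← bridge j _ (Γ.bridge_pos j).le le_rfl]
    exact congrArg f (pt_len Γ.graph (.bridge j)).symm
  have hw : ∀ j, f (.vertex (.w j)) = f Γ.leftEnd := by
    intro j
    induction j using Fin.induction with
    | zero => rfl
    | succ k ih =>
      rw [← ih, ← hv k.castSucc, ← (loop k _ (Γ.top_pos k).le).1 le_rfl]
      exact congrArg f (pt_len Γ.graph (.top k)).symm
  cases y with
  | vertex y =>
    cases y with
    | w j => exact hw j
    | v j => rw [hv, hw]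
  | inner e t h0 h1 =>
    rw [← pt_inner h0 h1]
    cases e with
    | bridge j => rw [bridge j t h0.le h1.le, hw]
    | top k => rw [(loop k t h0.le).1 h1.le, hv, hw]
    | bot k => rw [(loop k t h0.le).2 h1.le, hv, hw]

end Harmonic

/-! ### The minimum of sums of functions on bridges and loops. -/

/-- The difference of two functions is constant on the loop with index `k`. -/
def DiffConstOnLoop (Γ : ChainOfLoops g) (k : Fin g) (f f' : Γ.graph.Point → ℝ) : Prop :=
  ∃ a : ℝ, ∀ t, 0 ≤ t →
    (t ≤ Γ.top k → f (Γ.graph.pt (.top k) t) - f' (Γ.graph.pt (.top k) t) = a) ∧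
    (t ≤ Γ.bot k → f (Γ.graph.pt (.bot k) t) - f' (Γ.graph.pt (.bot k) t) = a)

section DiffConst

variable {D D₁ D₂ : Γ.graph.Divisor} {x : Fin g → ℝ} {f f' : Γ.graph.Point → ℝ}

theorem fwdSlope_eq_of_sub_eq {e : Edge g} (hf' : Γ.graph.IsPL f') {a : ℝ}
    (h : ∀ t, 0 ≤ t → t ≤ Γ.graph.len e → f (Γ.graph.pt e t) - f' (Γ.graph.pt e t) = a) :
    Γ.graph.fwdSlope f e 0 = Γ.graph.fwdSlope f' e 0 := by
  refine HasFwdSlope.fwdSlope_eq ?_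
  filter_upwards [hf'.hasFwdSlope le_rfl (Γ.graph.len_pos e),
    Ioo_mem_nhdsGT (Γ.graph.len_pos e)] with s hs h1
  have := h s h1.1.le h1.2.le
  have := h 0 le_rfl (Γ.graph.len_pos e).le
  linarith

theorem bwdSlope_eq_of_sub_eq {e : Edge g} (hf' : Γ.graph.IsPL f') {a : ℝ}
    (h : ∀ t, 0 ≤ t → t ≤ Γ.graph.len e → f (Γ.graph.pt e t) - f' (Γ.graph.pt e t) = a) :
    Γ.graph.bwdSlope f e (Γ.graph.len e) = Γ.graph.bwdSlope f' e (Γ.graph.len e) := by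
  refine HasBwdSlope.bwdSlope_eq ?_
  filter_upwards [hf'.hasBwdSlope (Γ.graph.len_pos e) le_rfl,
    Ioo_mem_nhdsLT (Γ.graph.len_pos e)] with s hs h1
  have := h s h1.1.le h1.2.le
  have := h _ (Γ.graph.len_pos e).le le_rfl
  linarith

/-- Here `f` leaves no chip on the loop and `f'` exactly one. If both had the same slopes on the
loop, then the different slopes on the bridges before and after it would give `D₂` a chip at each of
the two vertices of the loop. -/
theorem not_diffConstOnLoop (hD : HasLoopChips D x) (hf : IsMove D D₁ f) (hf' : IsMove D D₂ f')
    {k : Fin g} (h : Γ.startSlope f k.succ = Γ.endSlope f k.castSucc + loopCount x k)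
    (h' : Γ.startSlope f' k.succ = Γ.endSlope f' k.castSucc + loopCount x k - 1)
    (hne : Γ.endSlope f k.castSucc ≠ Γ.endSlope f' k.castSucc)
    (hne' : Γ.startSlope f k.succ ≠ Γ.startSlope f' k.succ) : ¬ DiffConstOnLoop Γ k f f' := by
  rintro ⟨a, ha⟩
  obtain ⟨h1, h2, -, -⟩ := hf.eq_zero_of_startSlope_succ_eq hD h
  have t0 := fwdSlope_eq_of_sub_eq (e := .top k) hf'.isPL fun t h0 => (ha t h0).1
  have b0 := fwdSlope_eq_of_sub_eq (e := .bot k) hf'.isPL fun t h0 => (ha t h0).2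
  have t1 : Γ.graph.bwdSlope f (.top k) (Γ.top k) = Γ.graph.bwdSlope f' (.top k) (Γ.top k) :=
    bwdSlope_eq_of_sub_eq (e := .top k) hf'.isPL fun t h0 => (ha t h0).1
  have b1 : Γ.graph.bwdSlope f (.bot k) (Γ.bot k) = Γ.graph.bwdSlope f' (.bot k) (Γ.bot k) :=
    bwdSlope_eq_of_sub_eq (e := .bot k) hf'.isPL fun t h0 => (ha t h0).2
  have v1 := hf.v_eq hD k
  have v2 := hf'.v_eq hD k
  have w1 := hf.w_eq hD k
  have w2 := hf'.w_eq hD k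
  have e1 := hf'.effective (.vertex (.v k.castSucc))
  have e2 := hf'.effective (.vertex (.w k.succ))
  omega

end DiffConst

/-- A family of functions on a chain of loops that are linear on the bridges, with different slopes
`q j i`, and whose growth along the loops is controlled. -/
structure SlopeSystem (Γ : ChainOfLoops g) (φ : Fin (r + 1) → Γ.graph.Point → ℝ)
    (q : Fin (g + 1) → Fin (r + 1) → ℤ) : Prop where
  bridge : ∀ i j s t, 0 ≤ s → s ≤ t → t ≤ Γ.bridge j →
    φ i (Γ.graph.pt (.bridge j) t) - φ i (Γ.graph.pt (.bridge j) s) = q j i * (t - s)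
  injective : ∀ j, Function.Injective (q j)

/-- The total slope on a bridge of the functions in a multiset. -/
def totalSlope (q : Fin (g + 1) → Fin (r + 1) → ℤ) (j : Fin (g + 1)) (I : Sym (Fin (r + 1)) m) :
    ℤ := ((I : Multiset (Fin (r + 1))).map (q j)).sum

/-- The sum of the functions in a multiset. -/
def totalValue (φ : Fin (r + 1) → Γ.graph.Point → ℝ) (I : Sym (Fin (r + 1)) m)
    (y : Γ.graph.Point) : ℝ := ((I : Multiset (Fin (r + 1))).map fun i => φ i y).sum

section Tropical

variable {φ : Fin (r + 1) → Γ.graph.Point → ℝ} {q : Fin (g + 1) → Fin (r + 1) → ℤ}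
  {b : Sym (Fin (r + 1)) m → ℝ}

/-- The member `I` of the family attains the minimum at `y`. -/
def IsMinAt (φ : Fin (r + 1) → Γ.graph.Point → ℝ) (b : Sym (Fin (r + 1)) m → ℝ)
    (y : Γ.graph.Point) (I : Sym (Fin (r + 1)) m) : Prop :=
  ∀ J, totalValue φ I y + b I ≤ totalValue φ J y + b J

theorem SlopeSystem.totalValue_sub (hφ : SlopeSystem Γ φ q) (I : Sym (Fin (r + 1)) m)
    {j : Fin (g + 1)} {s t : ℝ} (hs : 0 ≤ s) (hst : s ≤ t) (ht : t ≤ Γ.bridge j) :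
    totalValue φ I (Γ.graph.pt (.bridge j) t) - totalValue φ I (Γ.graph.pt (.bridge j) s) =
      totalSlope q j I * (t - s) := by
  unfold totalValue totalSlope
  rw [← Multiset.sum_map_sub]
  simp only [hφ.bridge _ j s t hs hst ht]
  rw [Multiset.sum_map_mul_right]
  congr 1
  exact (Multiset.map_map (Int.cast : ℤ → ℝ) _ _ ▸
    (map_multiset_sum (Int.castRingHom ℝ) _).symm)

/-- In every neighborhood of an interior point of a bridge, the minimum is attained by two members
of the family with the same slope. -/
theorem SlopeSystem.exists_isMinAt_pair (hφ : SlopeSystem Γ φ q)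
    (hb : ∀ y, ∃ I J, I ≠ J ∧ IsMinAt φ b y I ∧ IsMinAt φ b y J) {j : Fin (g + 1)} {t₀ : ℝ}
    (h0 : 0 < t₀) (h1 : t₀ < Γ.bridge j) {P : ℝ → Prop} (hP : ∀ᶠ t in 𝓝 t₀, P t) :
    ∃ t, P t ∧ 0 < t ∧ t < Γ.bridge j ∧ ∃ I J, I ≠ J ∧ IsMinAt φ b (Γ.graph.pt (.bridge j) t) I ∧
      totalSlope q j I = totalSlope q j J := by
  have hS : {t | P t ∧ t ∈ Set.Ioo 0 (Γ.bridge j)} ∈ 𝓝 t₀ :=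
    hP.and (Ioo_mem_nhds h0 h1)
  have hinf := infinite_of_mem_nhds t₀ hS
  choose I J hIJ hI hJ using fun t => hb (Γ.graph.pt (.bridge j) t)
  -- There are finitely many pairs of multisets, so the same pair serves at two points of the
  -- bridge. Two affine functions that agree at two points have the same slope.
  obtain ⟨s, hs, t, ht, hst, heq⟩ :=
    hinf.exists_ne_map_eq_of_mapsTo (t := Set.univ) (f := fun t => (I t, J t))
      (fun _ _ => Set.mem_univ _) Set.finite_univ
  simp only [Prod.mk.injEq] at heq
  wlog hlt : s < t generalizing s t
  · exact this t ht s hs hst.symm ⟨heq.1.symm, heq.2.symm⟩ (lt_of_le_of_ne (not_lt.1 hlt) hst.symm)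
  refine ⟨t, ht.1, ht.2.1, ht.2.2, I t, J t, hIJ t, hI t, ?_⟩
  have e1 := hφ.totalValue_sub (I t) hs.2.1.le hlt.le ht.2.2.le
  have e2 := hφ.totalValue_sub (J t) hs.2.1.le hlt.le ht.2.2.le
  have a1 := hI t (J t)
  have a2 := hJ t (I t)
  have a3 := hI s (J t)
  have a4 := hJ s (I t)
  rw [heq.1] at a3
  rw [heq.2] at a4
  have : (totalSlope q j (I t) : ℝ) * (t - s) = totalSlope q j (J t) * (t - s) := by linarith
  exact_mod_cast mul_right_cancel₀ (sub_pos.2 hlt).ne' this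

/-- A point of a loop. -/
def OnLoop (Γ : ChainOfLoops g) (k : Fin g) (y : Γ.graph.Point) : Prop :=
  ∃ t, 0 ≤ t ∧ (t ≤ Γ.top k ∧ y = Γ.graph.pt (.top k) t ∨ t ≤ Γ.bot k ∧ y = Γ.graph.pt (.bot k) t)

/-- All functions increase along the loop with index `k`, by at most the length of the top edge. -/
def GrowsOnLoop (Γ : ChainOfLoops g) (φ : Fin (r + 1) → Γ.graph.Point → ℝ) (k : Fin g) : Prop :=
  ∀ i s t, 0 ≤ s → s ≤ t →
    (t ≤ Γ.top k → φ i (Γ.graph.pt (.top k) t) - φ i (Γ.graph.pt (.top k) s) ∈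
      Set.Icc 0 (Γ.top k)) ∧
    (t ≤ Γ.bot k → φ i (Γ.graph.pt (.bot k) t) - φ i (Γ.graph.pt (.bot k) s) ∈
      Set.Icc 0 (Γ.top k))

theorem GrowsOnLoop.mem_Icc {k : Fin g} (h : GrowsOnLoop Γ φ k) {y : Γ.graph.Point}
    (hy : OnLoop Γ k y) (i : Fin (r + 1)) :
    φ i y - φ i (.vertex (.v k.castSucc)) ∈ Set.Icc 0 (Γ.top k) ∧
    φ i (.vertex (.w k.succ)) - φ i y ∈ Set.Icc 0 (Γ.top k) := by
  obtain ⟨t, ht, ⟨h1, rfl⟩ | ⟨h1, rfl⟩⟩ := hy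
  · have a := (h i 0 t le_rfl ht).1 h1
    have b := (h i t _ ht h1).1 le_rfl
    rw [show Γ.graph.pt (.top k) 0 = .vertex (.v k.castSucc) from pt_zero Γ.graph (.top k)] at a
    rw [show Γ.graph.pt (.top k) (Γ.top k) = .vertex (.w k.succ) from
      pt_len Γ.graph (.top k)] at b
    exact ⟨a, b⟩
  · have a := (h i 0 t le_rfl ht).2 h1
    have b := (h i t _ ht h1).2 le_rfl
    rw [show Γ.graph.pt (.bot k) 0 = .vertex (.v k.castSucc) from pt_zero Γ.graph (.bot k)] at a
    rw [show Γ.graph.pt (.bot k) (Γ.bot k) = .vertex (.w k.succ) from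
      pt_len Γ.graph (.bot k)] at b
    exact ⟨a, b⟩

theorem GrowsOnLoop.totalValue_mem_Icc {k : Fin g} (h : GrowsOnLoop Γ φ k) {y : Γ.graph.Point}
    (hy : OnLoop Γ k y) (I : Sym (Fin (r + 1)) m) :
    totalValue φ I y - totalValue φ I (.vertex (.v k.castSucc)) ∈ Set.Icc 0 (m * Γ.top k) ∧
    totalValue φ I (.vertex (.w k.succ)) - totalValue φ I y ∈ Set.Icc 0 (m * Γ.top k) := by
  unfold totalValue
  rw [← Multiset.sum_map_sub, ← Multiset.sum_map_sub]
  constructor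
  · simpa using Multiset.sum_map_mem_Icc (fun i => (h.mem_Icc hy i).1) (I : Multiset (Fin (r + 1)))
  · simpa using Multiset.sum_map_mem_Icc (fun i => (h.mem_Icc hy i).2) (I : Multiset (Fin (r + 1)))

/-- A member that attains the minimum on a loop has at most the slope of a member that attains the
minimum far away from the loop on the bridge before it. -/
theorem SlopeSystem.totalSlope_le_of_isMinAt (hφ : SlopeSystem Γ φ q) {k : Fin g}
    (hk : GrowsOnLoop Γ φ k) {y : Γ.graph.Point} (hy : OnLoop Γ k y)
    {I J : Sym (Fin (r + 1)) m} (hI : IsMinAt φ b y I) {t : ℝ} (h0 : 0 ≤ t)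
    (h1 : t < Γ.bridge k.castSucc - m * Γ.top k)
    (hJ : IsMinAt φ b (Γ.graph.pt (.bridge k.castSucc) t) J) :
    totalSlope q k.castSucc I ≤ totalSlope q k.castSucc J := by
  have hm : 0 ≤ m * Γ.top k := mul_nonneg (Nat.cast_nonneg _) (Γ.top_pos k).le
  have e1 := hφ.totalValue_sub I h0 (by linarith : t ≤ Γ.bridge k.castSucc) le_rfl
  have e2 := hφ.totalValue_sub J h0 (by linarith : t ≤ Γ.bridge k.castSucc) le_rfl
  rw [show Γ.graph.pt (.bridge k.castSucc) (Γ.bridge k.castSucc) = .vertex (.v k.castSucc) from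
    pt_len Γ.graph (.bridge k.castSucc)] at e1 e2
  have a1 := (hk.totalValue_mem_Icc hy I).1
  have a2 := (hk.totalValue_mem_Icc hy J).1
  have a3 := hI J
  have a4 := hJ I
  by_contra hlt
  have h2 : (totalSlope q k.castSucc J : ℝ) + 1 ≤ totalSlope q k.castSucc I := by
    exact_mod_cast not_le.1 hlt
  -- With a larger slope, `I` would rise above `J` on the rest of the bridge by more than `m * Γ.top
  -- k`, which is all that can be made up on the loop.
  have h3 : ((totalSlope q k.castSucc J : ℝ) + 1) * (Γ.bridge k.castSucc - t) ≤
      totalSlope q k.castSucc I * (Γ.bridge k.castSucc - t) :=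
    mul_le_mul_of_nonneg_right h2 (by linarith)
  linarith [a1.1, a2.2]

/-- The counterpart of `totalSlope_le_of_isMinAt` for the bridge after the loop. -/
theorem SlopeSystem.le_totalSlope_of_isMinAt (hφ : SlopeSystem Γ φ q) {k : Fin g}
    (hk : GrowsOnLoop Γ φ k) {y : Γ.graph.Point} (hy : OnLoop Γ k y)
    {I J : Sym (Fin (r + 1)) m} (hI : IsMinAt φ b y I) {t : ℝ} (h0 : m * Γ.top k < t)
    (h1 : t ≤ Γ.bridge k.succ)
    (hJ : IsMinAt φ b (Γ.graph.pt (.bridge k.succ) t) J) :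
    totalSlope q k.succ J ≤ totalSlope q k.succ I := by
  have hm : 0 ≤ m * Γ.top k := mul_nonneg (Nat.cast_nonneg _) (Γ.top_pos k).le
  have e1 := hφ.totalValue_sub I le_rfl (by linarith : 0 ≤ t) h1
  have e2 := hφ.totalValue_sub J le_rfl (by linarith : 0 ≤ t) h1
  rw [show Γ.graph.pt (.bridge k.succ) 0 = .vertex (.w k.succ) from
    pt_zero Γ.graph (.bridge k.succ), sub_zero] at e1 e2
  have a1 := (hk.totalValue_mem_Icc hy I).2
  have a2 := (hk.totalValue_mem_Icc hy J).2
  have a3 := hI J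
  have a4 := hJ I
  by_contra hlt
  have h2 : (totalSlope q k.succ I : ℝ) + 1 ≤ totalSlope q k.succ J := by
    exact_mod_cast not_le.1 hlt
  have h3 : ((totalSlope q k.succ I : ℝ) + 1) * t ≤ totalSlope q k.succ J * t :=
    mul_le_mul_of_nonneg_right h2 (by linarith)
  linarith [a1.2, a2.1]

theorem totalSlope_succ {k : Fin g} {a : ℤ} (h : ∀ i, q k.succ i = q k.castSucc i + a)
    (I : Sym (Fin (r + 1)) m) :
    totalSlope q k.succ I = totalSlope q k.castSucc I + m * a := by
  unfold totalSlope
  rw [Multiset.map_congr rfl fun i _ => h i, Multiset.sum_map_add]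
  simp

theorem totalSlope_succ_of_ite {k : Fin g} {a : ℤ} {j : Fin (r + 1)}
    (h : ∀ i, q k.succ i = q k.castSucc i + a + if i = j then 1 else 0)
    (I : Sym (Fin (r + 1)) m) :
    totalSlope q k.succ I = totalSlope q k.castSucc I + m * a +
      (I : Multiset (Fin (r + 1))).count j := by
  unfold totalSlope
  rw [Multiset.map_congr rfl fun i _ => h i, Multiset.sum_map_add, Multiset.sum_map_add]
  have : ((I : Multiset (Fin (r + 1))).map fun i => if i = j then (1 : ℤ) else 0).sum =
      (I : Multiset (Fin (r + 1))).count j := by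
    induction (I : Multiset (Fin (r + 1))) using Multiset.induction with
    | empty => simp
    | cons i s ih =>
      rw [Multiset.map_cons, Multiset.sum_cons, ih, Multiset.count_cons]
      push_cast
      simp only [eq_comm (a := i) (b := j)]
      ring
  rw [this]
  simp

/-- On every loop the slope of the minimum drops enough to leave at least two chips there. -/
theorem SlopeSystem.totalSlope_succ_le (hφ : SlopeSystem Γ φ q)
    (hb : ∀ y, ∃ I J, I ≠ J ∧ IsMinAt φ b y I ∧ IsMinAt φ b y J) (hm : 2 ≤ m) {k : Fin g}
    (hk : GrowsOnLoop Γ φ k) {c : ℤ}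
    (hq : (∀ i, q k.succ i = q k.castSucc i + (c - 1)) ∨
      ∃ j, (∀ i, q k.succ i = q k.castSucc i + (c - 1) + if i = j then 1 else 0) ∧
        ∀ i, i ≠ j → ¬ DiffConstOnLoop Γ k (φ j) (φ i))
    {s t : ℝ} (hs0 : 0 ≤ s) (hs1 : s < Γ.bridge k.castSucc - m * Γ.top k)
    (ht0 : m * Γ.top k < t) (ht1 : t ≤ Γ.bridge k.succ) {J J' : Sym (Fin (r + 1)) m}
    (hJ : IsMinAt φ b (Γ.graph.pt (.bridge k.castSucc) s) J)
    (hJ' : IsMinAt φ b (Γ.graph.pt (.bridge k.succ) t) J') :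
    totalSlope q k.succ J' ≤ totalSlope q k.castSucc J + m * c - 2 := by
  by_contra hlt
  -- If the claim fails, every multiset attaining the minimum on the loop loses at most one against
  -- the maximal change `m * c` of the slope.
  have key : ∀ y, OnLoop Γ k y → ∀ I, IsMinAt φ b y I →
      totalSlope q k.castSucc I ≤ totalSlope q k.castSucc J ∧
      totalSlope q k.castSucc J + m * c - 1 ≤ totalSlope q k.succ I := by
    intro y hy I hI
    have h1 := hφ.totalSlope_le_of_isMinAt hk hy hI hs0 hs1 hJ
    have h2 := hφ.le_totalSlope_of_isMinAt hk hy hI ht0 ht1 hJ'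
    exact ⟨h1, by linarith⟩
  have hv : OnLoop Γ k (Γ.graph.pt (.top k) 0) := ⟨0, le_rfl, .inl ⟨(Γ.top_pos k).le, rfl⟩⟩
  rcases hq with hq | ⟨j, hq, hconst⟩
  · obtain ⟨I, -, -, hI, -⟩ := hb (Γ.graph.pt (.top k) 0)
    obtain ⟨h1, h2⟩ := key _ hv I hI
    rw [totalSlope_succ hq, mul_sub] at h2
    have : (2 : ℤ) ≤ m := by exact_mod_cast hm
    linarith
  set R : Multiset (Fin (r + 1)) := Multiset.replicate (m - 1) j with hR
  have hcard : ∀ i, (i ::ₘ R).card = m := fun i => by simp [hR]; omega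
  set S : Fin (r + 1) → Sym (Fin (r + 1)) m := fun i => ⟨i ::ₘ R, hcard i⟩ with hS
  -- Every member other than the exceptional `j` costs one, so at most one member differs from `j`.
  -- If one does, then both inequalities in `key` are equalities, which fixes its slope and hence,
  -- by injectivity, the member itself.
  have hform : ∀ y, OnLoop Γ k y → ∀ I, IsMinAt φ b y I → ∃ i, I = S i ∧
      (i ≠ j → q k.castSucc i = totalSlope q k.castSucc J - (R.map (q k.castSucc)).sum) := by
    intro y hy I hI
    obtain ⟨h1, h2⟩ := key y hy I hI
    rw [totalSlope_succ_of_ite hq, mul_sub] at h2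
    have h3 : m - 1 ≤ (I : Multiset (Fin (r + 1))).count j := by omega
    rw [Multiset.le_count_iff_replicate_le] at h3
    obtain ⟨T, hT⟩ := Multiset.le_iff_exists_add.1 h3
    have h4 : T.card = 1 := by
      have := congrArg Multiset.card hT
      rw [Sym.card_coe, Multiset.card_add, Multiset.card_replicate] at this
      omega
    obtain ⟨i, rfl⟩ := Multiset.card_eq_one.1 h4
    have h5 : (I : Multiset (Fin (r + 1))) = i ::ₘ R := by
      rw [hT, add_comm (Multiset.replicate _ _), Multiset.singleton_add]
    refine ⟨i, Sym.coe_injective h5, fun hij => ?_⟩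
    have h6 : (I : Multiset (Fin (r + 1))).count j = m - 1 := by
      rw [h5, Multiset.count_cons_of_ne hij.symm, hR, Multiset.count_replicate_self]
    have h7 : totalSlope q k.castSucc I = totalSlope q k.castSucc J := by omega
    rw [← h7, totalSlope, h5, Multiset.map_cons, Multiset.sum_cons]
    ring
  have hval : ∀ i y, totalValue φ (S i) y = φ i y + (R.map fun l => φ l y).sum := by
    intro i y
    simp [totalValue, hS]
  -- The minimum is attained twice, so one of the two multisets is `S j` and the other is `S i` with
  -- `i ≠ j`.
  have hpair : ∀ y, OnLoop Γ k y → ∃ i, i ≠ j ∧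
      q k.castSucc i = totalSlope q k.castSucc J - (R.map (q k.castSucc)).sum ∧
      φ j y - φ i y = b (S i) - b (S j) := by
    intro y hy
    obtain ⟨I, I', hne, hI, hI'⟩ := hb y
    obtain ⟨i, rfl, hi⟩ := hform y hy I hI
    obtain ⟨i', rfl, hi'⟩ := hform y hy I' hI'
    have h1 := hI (S i')
    have h2 := hI' (S i)
    rw [hval, hval] at h1 h2
    by_cases hij : i = j
    · subst hij
      have hij' : i' ≠ i := fun h => hne (by rw [h])
      exact ⟨i', hij', hi' hij', by linarith⟩
    · by_cases hij' : i' = j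
      · subst hij'
        exact ⟨i, hij, hi hij, by linarith⟩
      · exact absurd (hφ.injective _ ((hi hij).trans (hi' hij').symm)) fun h => hne (by rw [h])
  obtain ⟨i₀, hi₀, hq₀, -⟩ := hpair _ hv
  have hall : ∀ y, OnLoop Γ k y → φ j y - φ i₀ y = b (S i₀) - b (S j) := by
    intro y hy
    obtain ⟨i, -, hi, h⟩ := hpair y hy
    obtain rfl : i = i₀ := hφ.injective _ (hi.trans hq₀.symm)
    exact h
  exact hconst i₀ hi₀ ⟨_, fun t h0 =>
    ⟨fun h1 => hall _ ⟨t, h0, .inl ⟨h1, rfl⟩⟩, fun h1 => hall _ ⟨t, h0, .inr ⟨h1, rfl⟩⟩⟩⟩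

end Tropical

end ChainOfLoops

/-! ### Proof of the theorem. -/

namespace ChainOfLoops

open MetricGraph

variable {g r d m : ℕ} {Γ : ChainOfLoops g} {D : Γ.graph.Divisor}

/-- This form bounds the slope of the minimum from above on the first bridge;
`totalSlope_eq_natCast` bounds it from below on the last one. -/
theorem totalSlope_eq_sub {q : Fin (g + 1) → Fin (r + 1) → ℤ} {j : Fin (g + 1)}
    (h : ∀ i, q j i = r - (i : ℕ)) (I : Sym (Fin (r + 1)) m) :
    totalSlope q j I = m * r - ((I : Multiset (Fin (r + 1))).map fun i : Fin (r + 1) => (i : ℕ)).sum := by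
  unfold totalSlope
  rw [Multiset.map_congr rfl fun i _ => h i, Multiset.sum_map_sub, Nat.cast_multiset_sum,
    Multiset.map_map]
  simp

theorem totalSlope_eq_natCast {q : Fin (g + 1) → Fin (r + 1) → ℤ} {j : Fin (g + 1)}
    (h : ∀ i, q j i = r - (i : ℕ)) (I : Sym (Fin (r + 1)) m) :
    totalSlope q j I = ((I : Multiset (Fin (r + 1))).map fun i : Fin (r + 1) => r - (i : ℕ)).sum := by
  unfold totalSlope
  rw [Nat.cast_multiset_sum, Multiset.map_map]
  refine congrArg _ (Multiset.map_congr rfl fun i _ => ?_)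
  have := i.isLt
  rw [h, Function.comp_apply, Nat.cast_sub (by omega)]

/-- Functions with the same divisor differ by a constant. -/
theorem eq_totalValue_add (hbt : ∀ k, Γ.bot k ≤ Γ.top k) {φ : Fin (r + 1) → Γ.graph.Point → ℝ}
    {Di : Fin (r + 1) → Γ.graph.Divisor} (hφ : ∀ i, IsMove D (Di i) (φ i))
    {I : Sym (Fin (r + 1)) m} {ψ : Γ.graph.Point → ℝ} (hψ : Γ.graph.IsPL ψ)
    (hdiv : ∀ x, (m • D) x + Γ.graph.div ψ x = ((I : Multiset (Fin (r + 1))).map Di).sum x)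
    (y : Γ.graph.Point) :
    ψ y = totalValue φ I y + (ψ Γ.leftEnd - totalValue φ I Γ.leftEnd) := by
  have hPL := isPL_multiset_sum (fun i => (hφ i).isPL) (I : Multiset (Fin (r + 1)))
  have hval : ∀ y, ((I : Multiset (Fin (r + 1))).map φ).sum y = totalValue φ I y := by
    intro y
    unfold totalValue
    induction (I : Multiset (Fin (r + 1))) using Multiset.induction with
    | empty => simp
    | cons i s ih => simp [ih]
  have h := eq_of_div_eq_zero hbt (hψ.add hPL.neg) (fun x => ?_) y
  · simp only [Pi.add_apply, Pi.neg_apply, hval] at h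
    linarith
  · rw [div_add hψ hPL.neg, div_neg hPL, div_multiset_sum fun i => (hφ i).isPL]
    have h1 := hdiv x
    have h2 : ((I : Multiset (Fin (r + 1))).map Di).sum x =
        ((I : Multiset (Fin (r + 1))).map fun i => Di i x).sum := by
      induction (I : Multiset (Fin (r + 1))) using Multiset.induction with
      | empty => simp
      | cons i s ih => simp [ih]
    rw [h2, Multiset.map_congr rfl fun i _ => (hφ i).eq_add_div x, Multiset.sum_map_add] at h1
    simp at h1
    linarith

end ChainOfLoops

open ChainOfLoops MetricGraph in
theorem theorem4p3 {g r d m : ℕ} (Γ : ChainOfLoops g) (hΓ : Γ.Admissible m)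
    (D : Γ.graph.Divisor)
    (hD_reduced : MetricGraph.IsReduced D Γ.leftEnd)
    (hD_degree : MetricGraph.degree D = d)
    (hD_rank : MetricGraph.HasRank D r)
    (hD_avoiding : Γ.IsVertexAvoiding D r d)
    -- the representatives `D_0, …, D_r` of the class of `D`
    (Di : Fin (r + 1) → Γ.graph.Divisor)
    (hDi_equiv : ∀ i, MetricGraph.LinEquiv D (Di i))
    (hDi_effective : ∀ i, MetricGraph.IsEffective (Di i - Finsupp.single Γ.leftEnd ((i : ℕ) : ℤ)
      - Finsupp.single Γ.rightEnd ((r : ℤ) - (i : ℕ))))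
    -- the functions `ψ_I`, with `m D + div ψ_I` the sum of `D_i` over `i` in `I`
    (ψ : Sym (Fin (r + 1)) m → Γ.graph.Point → ℝ)
    (hψ_PL : ∀ I, Γ.graph.IsPL (ψ I))
    (hψ_div : ∀ I x, (m • D) x + Γ.graph.div (ψ I) x =
      ((I : Multiset (Fin (r + 1))).map Di).sum x)
    (hmd : m * d < 2 * g + 4) :
    TropicallyIndependent ψ := by
  classical
  rintro ⟨b, hb⟩
  rcases Nat.eq_zero_or_pos m with rfl | hm1
  · obtain ⟨I, J, hIJ, -⟩ := hb Γ.leftEnd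
    exact hIJ (Subsingleton.elim _ _)
  have hchips := hasLoopChips_of_isReduced hD_reduced fun k h =>
    hD_avoiding.ne_bot k (h ▸ AddCommGroup.modEq_rfl)
  have hd : D Γ.leftEnd + ∑ k, loopCount (Γ.chipPos D) k ≤ d :=
    hD_degree ▸ hchips.sum_loopCount_le hD_reduced.1
  have hd' : d ≤ 2 * g + 3 := by nlinarith
  choose φ hφPL hφ using hDi_equiv
  have hne : Γ.leftEnd ≠ Γ.rightEnd := by simp [leftEnd, rightEnd]
  have heff : ∀ i y, 0 ≤ Di i y - Finsupp.single Γ.leftEnd ((i : ℕ) : ℤ) y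
      - Finsupp.single Γ.rightEnd ((r : ℤ) - (i : ℕ)) y := hDi_effective
  have hir : ∀ i : Fin (r + 1), 0 ≤ (r : ℤ) - (i : ℕ) := fun i => by omega
  have hmove : ∀ i, IsMove D (Di i) (φ i) := by
    intro i
    refine ⟨hφPL i, fun y => ?_, hφ i⟩
    have h1 := heff i y
    have h2 := hir i
    rw [Finsupp.single_apply, Finsupp.single_apply] at h1
    split_ifs at h1 <;> linarith
  have hleft : ∀ i : Fin (r + 1), ((i : ℕ) : ℤ) ≤ Di i Γ.leftEnd := by
    intro i
    have h1 := heff i Γ.leftEnd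
    rw [Finsupp.single_eq_same, Finsupp.single_eq_of_ne hne] at h1
    linarith
  have hright : ∀ i : Fin (r + 1), (r : ℤ) - (i : ℕ) ≤ Di i Γ.rightEnd := by
    intro i
    have h1 := heff i Γ.rightEnd
    rw [Finsupp.single_eq_same, Finsupp.single_eq_of_ne hne.symm] at h1
    linarith
  have hbounds : SlopeBounds Γ D r (fun i => Γ.startSlope (φ i)) (fun i => Γ.endSlope (φ i)) := by
    refine ⟨fun i k => (hmove i).endSlope_le_startSlope hchips k, fun i => ?_, fun i => ?_,
      fun i k => (hmove i).startSlope_succ_le hchips k,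
      fun i k h => (hmove i).modEq_of_startSlope_succ_eq hchips h,
      hchips.nonneg, hchips.lt_circ, fun k => ?_⟩
    · rw [(hmove i).startSlope_zero]
      linarith [hleft i]
    · rw [(hmove i).endSlope_last hchips]
      exact hright i
    -- A loop exists, so `g ≥ 1` and `d ≤ 2g + 3 ≤ 4g + 1`. The extra `1` is paid for by the bottom
    -- edge as part of the circumference.
    · have h1 : (D Γ.leftEnd + ∑ l, loopCount (Γ.chipPos D) l : ℤ) ≤ 4 * g + 1 := by
        have := k.pos
        omega
      have h2 : ((D Γ.leftEnd + ∑ l, loopCount (Γ.chipPos D) l : ℤ) : ℝ) ≤ 4 * g + 1 := by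
        exact_mod_cast h1
      have h3 := mul_le_mul_of_nonneg_right h2 (Γ.bot_pos k).le
      have h4 := hΓ.bot_lt_top k
      unfold circ
      push_cast at h3 ⊢
      linarith
  have hstart : ∀ i k, Γ.startSlope (φ i) k = Γ.extendedPath D r k i :=
    hbounds.start_eq hD_avoiding hd
  have hend : ∀ i k, Γ.endSlope (φ i) k = Γ.extendedPath D r k i := hbounds.end_eq hD_avoiding hd
  have hsys : SlopeSystem Γ φ (Γ.extendedPath D r) := by
    refine ⟨fun i j s t h0 h1 h2 => ?_, fun j =>
      extendedPath_injective (hbounds.path_bound hD_avoiding j).1⟩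
    rw [(hmove i).sub_eq_of_slopes_eq hchips (by rw [hstart, hend]) h0 h1 h2, hstart]
  have hbt : ∀ k, Γ.bot k ≤ Γ.top k := by
    intro k
    have h1 := hΓ.bot_lt_top k
    have h2 := Γ.bot_pos k
    have h3 : (1 : ℝ) ≤ g := by exact_mod_cast k.pos
    nlinarith
  have hψ : ∀ I y, ψ I y = totalValue φ I y + (ψ I Γ.leftEnd - totalValue φ I Γ.leftEnd) :=
    fun I y => eq_totalValue_add hbt hmove (hψ_PL I) (hψ_div I) y
  -- The constants by which `ψ I` and the sum of the `φ i` differ are absorbed into `b`.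
  set b' : Sym (Fin (r + 1)) m → ℝ :=
    fun I => ψ I Γ.leftEnd - totalValue φ I Γ.leftEnd + b I with hb'
  have hmin : ∀ y, ∃ I J, I ≠ J ∧ IsMinAt φ b' y I ∧ IsMinAt φ b' y J := by
    intro y
    obtain ⟨I, J, hIJ, h1, h2⟩ := hb y
    have h3 : ∀ K, totalValue φ K y + b' K = ψ K y + b K := by
      intro K
      rw [hψ K y, hb']
      ring
    refine ⟨I, J, hIJ, fun K => ?_, fun K => ?_⟩
    · rw [h3, h3]
      exact h2 K
    · rw [h3, h3, ← h1]
      exact h2 K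
  have hpair : ∀ j : Fin (g + 1), ∃ t, ((∀ l : Fin g, l.succ = j → m * Γ.top l < t) ∧
      ∀ l : Fin g, l.castSucc = j → t < Γ.bridge j - m * Γ.top l) ∧ 0 < t ∧ t < Γ.bridge j ∧
      ∃ I J, I ≠ J ∧ IsMinAt φ b' (Γ.graph.pt (.bridge j) t) I ∧
        totalSlope (Γ.extendedPath D r) j I = totalSlope (Γ.extendedPath D r) j J := by
    intro j
    have h0 := Γ.bridge_pos j
    -- By admissibility the midpoint is farther than `m * Γ.top l` from the adjacent loops.
    refine hsys.exists_isMinAt_pair hmin (t₀ := Γ.bridge j / 2) (by linarith) (by linarith) ?_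
    refine Eventually.and (eventually_all.2 fun l => ?_) (eventually_all.2 fun l => ?_)
    · rw [eventually_imp_distrib_left]
      rintro rfl
      have h1 := (hΓ.top_lt_bridge l).trans_le (min_le_right _ _)
      exact lt_mem_nhds (by linarith)
    · rw [eventually_imp_distrib_left]
      rintro rfl
      have h1 := (hΓ.top_lt_bridge l).trans_le (min_le_left _ _)
      exact gt_mem_nhds (by linarith)
  choose t ht ht0 ht1 I J hIJ hI hslope using hpair
  -- This improves the bound on `d` to `g + 1`, so that slopes plus one are at most `4g`, as
  -- `sub_mem_Icc` requires.
  have hm2 : 2 ≤ m := Sym.two_le_of_ne (hsys.injective 0) (hIJ 0) (hslope 0)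
  have hdg : d ≤ g + 1 := by
    have := Nat.mul_le_mul_right d hm2
    omega
  have hgrow : ∀ k, GrowsOnLoop Γ φ k := by
    intro k i s t hs hst
    have hq0 : 0 ≤ Γ.endSlope (φ i) k.castSucc := hbounds.nonneg i k.castSucc
    refine (hmove i).sub_mem_Icc hchips ?_ hq0 ?_ hs hst
    · rw [hend, hstart]
      rcases extendedPath_succ (D := D) (r := r) k with h | ⟨j, h⟩
      · rw [h i]; linarith
      · rw [h i]; split_ifs <;> linarith
    · have h1 : Γ.endSlope (φ i) k.castSucc + 1 ≤ 4 * g := by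
        have h2 : Γ.endSlope (φ i) k.castSucc ≤ d := by
          rw [hend]
          cases i using Fin.lastCases with
          | last => simp
          | cast i =>
            rw [extendedPath_castSucc]
            exact (latticePath_le _ i).trans hd
        have := k.pos
        omega
      have h2 : ((Γ.endSlope (φ i) k.castSucc : ℝ) + 1) ≤ 4 * g := by exact_mod_cast h1
      exact (mul_le_mul_of_nonneg_right h2 (Γ.bot_pos k).le).trans (hΓ.bot_lt_top k).le
  have hstep : ∀ k : Fin g, totalSlope (Γ.extendedPath D r) k.succ (I k.succ) ≤
      totalSlope (Γ.extendedPath D r) k.castSucc (I k.castSucc) +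
        m * loopCount (Γ.chipPos D) k - 2 := by
    intro k
    refine hsys.totalSlope_succ_le hmin hm2 (hgrow k) ?_ (ht0 k.castSucc).le
      ((ht k.castSucc).2 k rfl) ((ht k.succ).1 k rfl) (ht1 k.succ).le (hI _) (hI _)
    simp only [← add_sub_assoc]
    refine extendedPath_succ (D := D) (r := r) k |>.imp id ?_
    rintro ⟨j, hj⟩
    refine ⟨j, hj, fun i hij => not_diffConstOnLoop hchips (hmove j) (hmove i) ?_ ?_ ?_ ?_⟩
    · rw [hstart, hend, hj j, if_pos rfl]; ring
    · rw [hstart, hend, hj i, if_neg hij]; ring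
    · rw [hend, hend]; exact fun h => hij (hsys.injective _ h).symm
    · rw [hstart, hstart]; exact fun h => hij (hsys.injective _ h).symm
  obtain ⟨hr, hlast⟩ := hbounds.last_eq hD_avoiding hd
  have hq0 : ∀ i, Γ.extendedPath D r 0 i = r - (i : ℕ) := by
    intro i
    cases i using Fin.lastCases with
    | last => simp
    | cast i => simp [latticePath_zero, hr]
  have hqg : ∀ i, Γ.extendedPath D r (Fin.last g) i = r - (i : ℕ) := by
    intro i
    cases i using Fin.lastCases with
    | last => simp
    | cast i => simp [hlast]
  have hfirst : totalSlope (Γ.extendedPath D r) 0 (I 0) ≤ m * r - 2 := by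
    have h1 := hslope 0
    rw [totalSlope_eq_sub hq0, totalSlope_eq_sub hq0] at h1
    have h2 := Sym.map_sum_ge_two_of_ne (f := fun i : Fin (r + 1) => (i : ℕ)) Fin.val_injective
      (hIJ 0) (by omega)
    rw [totalSlope_eq_sub hq0]
    omega
  have hfinal : 2 ≤ totalSlope (Γ.extendedPath D r) (Fin.last g) (I (Fin.last g)) := by
    have h1 := hslope (Fin.last g)
    rw [totalSlope_eq_natCast hqg, totalSlope_eq_natCast hqg] at h1
    have hinj : Function.Injective fun i : Fin (r + 1) => r - (i : ℕ) := by
      intro i j hij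
      simp only at hij
      ext
      omega
    have h2 := Sym.map_sum_ge_two_of_ne hinj (hIJ (Fin.last g)) (by exact_mod_cast h1)
    rw [totalSlope_eq_natCast hqg]
    exact_mod_cast h2
  -- Telescoping over the loops: with `N` chips on the loops, `2 ≤ (mr - 2) + mN - 2g`, while `r + N
  -- ≤ d`.
  have hsum := sum_succ_sub_castSucc fun k => totalSlope (Γ.extendedPath D r) k (I k)
  have hle : ∑ k : Fin g, (totalSlope (Γ.extendedPath D r) k.succ (I k.succ) -
      totalSlope (Γ.extendedPath D r) k.castSucc (I k.castSucc)) ≤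
      ∑ k, (m * loopCount (Γ.chipPos D) k - 2) :=
    Finset.sum_le_sum fun k _ => by linarith [hstep k]
  rw [hsum, Finset.sum_sub_distrib, ← Finset.mul_sum] at hle
  simp only [Finset.sum_const, Finset.card_univ, Fintype.card_fin, nsmul_eq_mul] at hle
  have h1 : (m : ℤ) * (D Γ.leftEnd + ∑ k, loopCount (Γ.chipPos D) k) ≤ m * d :=
    mul_le_mul_of_nonneg_left hd (by positivity)
  have h2 : (m : ℤ) * d < 2 * g + 4 := by exact_mod_cast hmd
  rw [hr] at h1
  linarith
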